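/- Let $\mathcal Z$ be a measurable space, $\mathcal W$ a nonempty standard Borel space, $K,n\ge 1$, and let $\ell:\mathcal W\times\mathcal Z\to[a,b]$ be a measurable bounded loss. There are $K$ clients; client $k$ has a fixed data distribution $P_k$ on $\mathcal Z$ (a two-layer sampling tree whose first layer depends deterministically on the position $k$: $\mu_1^k=P_k$) and $n$ i.i.d. samples $Z_k=(Z_{k,1},\dots,Z_{k,n})\sim P_k^{\otimes n}$, independent across clients. Client $k$ forms a local hypothesis $W_k\in\mathcal W$ from $Z_k$ by a Markov kernel $P_{W_k\mid Z_k}$, independently of the other clients, and the server forms $W\in\mathcal W$ from $(W_1,\dots,W_K)$ by a Markov kernel. The generalization error is $$\mathrm{gen}=\mathbb E\Big[\frac1K\sum_{k=1}^K\mathbb E_{z\sim P_k}[\ell(W,z)]-\frac1{nK}\sum_{k=1}^K\sum_{j=1}^n\ell(W,Z_{k,j})\Big].$$ Supersample. For each $k$, let $\tilde\mu_1^k$ be the pair of first-layer candidates (here $(P_k,P_k)$), with a uniform selector $U_1^k\in\{1,2\}$; for each $k,j$, let $\tilde Z_{k,j}$ be a pair of points drawn i.i.d. from the selected first-layer candidate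 (here $P_k$), with a uniform selector $J_{k,j}\in\{1,2\}$, all selectors being independent of one another and of the candidates $\tilde\mu_1,\tilde Z$. The algorithm is trained on the selected points. Write $\tilde Z_k=(\tilde Z_{k,j})_j$, $J_k=(J_{k,j})_j$, let $\mathbb W$ be the Wasserstein-1 distance for the discrete metric on $\mathcal W$ (for which $\ell(\cdot,z)$ is $(b-a)$-Lipschitz), and let $$\mathcal B=2(b-a)\Big[\frac1K\sum_{k=1}^K\mathbb E\,\mathbb W\big(P_{W\mid\tilde\mu_1^k,U_1^k},P_{W\mid\tilde\mu_1^k}\big)+\frac1{nK}\sum_{k=1}^K\sum_{j=1}^n\mathbb E\,\mathbb W\big(P_{W\mid\tilde Z_{k,j},J_{k,j}},P_{W\mid\tilde Z_{k,j}}\big)\Big]$$ be the hierarchical Wasserstein bound for this depth-two tree. Then $$|\mathrm{gen}|\;\le\;\mathcal B\;\le\;(b-a)\sqrt{\frac{2}{nK}\sum_{k=1}^K I(W_k;J_k\mid\tilde Z_k)},$$ where $I$ is the conditional mutual information in nats. In particular, for losses in $[0,1]$, the Wasserstein bound implies the bound of Theorem 1 of Kavian et al., $\mathrm{gen}\le\sqrt{\frac{2}{nK}\sum_k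 I(W_k;J_k\mid\tilde Z_k)}$. -/

import Mathlib

open MeasureTheory ProbabilityTheory
open scoped ENNReal

noncomputable section

namespace HierFL

/-! ### Product kernels -/

/-- The kernel `x ↦ ⨂ i, κ i x`: given `x`, the coordinates are independent with laws `κ i x`. -/
def kernelPi {ι X : Type*} [Fintype ι] {Y : ι → Type*} [MeasurableSpace X]
    [∀ i, MeasurableSpace (Y i)] (κ : ∀ i, Kernel X (Y i)) [∀ i, IsMarkovKernel (κ i)] :
    Kernel X (∀ i, Y i) where
  toFun x := Measure.pi fun i => κ i x
  measurable' := by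
    refine Measurable.measure_of_isPiSystem_of_isProbabilityMeasure
      generateFrom_pi.symm isPiSystem_pi ?_
    rintro _ ⟨t, ht, rfl⟩
    simp_rw [Measure.pi_pi]
    exact Finset.measurable_prod _ fun i _ =>
      (κ i).measurable_coe (ht i (Set.mem_univ i))

instance {ι X : Type*} [Fintype ι] {Y : ι → Type*} [MeasurableSpace X]
    [∀ i, MeasurableSpace (Y i)] (κ : ∀ i, Kernel X (Y i)) [∀ i, IsMarkovKernel (κ i)] :
    IsMarkovKernel (kernelPi κ) :=
  ⟨fun x => inferInstanceAs (IsProbabilityMeasure (Measure.pi fun i => κ i x))⟩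

/-- The sampling kernel: given a distribution `p` on `𝒵`, draw a point from `p`. -/
def evalKernel (𝒵 : Type*) [MeasurableSpace 𝒵] : Kernel (ProbabilityMeasure 𝒵) 𝒵 where
  toFun p := (p : Measure 𝒵)
  measurable' := measurable_subtype_coe

instance (𝒵 : Type*) [MeasurableSpace 𝒵] : IsMarkovKernel (evalKernel 𝒵) :=
  ⟨fun p => p.2⟩

/-! ### Information measures -/

/-- Wasserstein-1 distance with respect to the distance `ρ`: infimum of the transport cost
over all couplings. -/
def wasserstein {𝒲 : Type*} [MeasurableSpace 𝒲] (ρ : 𝒲 → 𝒲 → ℝ) (P Q : Measure 𝒲) : ℝ≥0∞ :=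
  ⨅ (π : Measure (𝒲 × 𝒲)) (_ : π.map Prod.fst = P) (_ : π.map Prod.snd = Q),
    ∫⁻ x, ENNReal.ofReal (ρ x.1 x.2) ∂π

open Classical in
/-- The discrete metric. -/
def discreteDist {𝒲 : Type*} (w w' : 𝒲) : ℝ := if w = w' then 0 else 1

/-- `𝔼_{X,U} 𝕎(P_{W|X,U}, P_{W|X})`. -/
def expectedWasserstein {Ω 𝒳 𝒰 𝒲 : Type*} [MeasurableSpace Ω] [MeasurableSpace 𝒳]
    [MeasurableSpace 𝒰] [MeasurableSpace 𝒲] [StandardBorelSpace 𝒲] [Nonempty 𝒲]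
    (ρ : 𝒲 → 𝒲 → ℝ) (μ : Measure Ω) [IsFiniteMeasure μ]
    (W : Ω → 𝒲) (X : Ω → 𝒳) (U : Ω → 𝒰) : ℝ≥0∞ :=
  ∫⁻ ω, wasserstein ρ (condDistrib W (fun ω => (X ω, U ω)) μ (X ω, U ω))
    (condDistrib W X μ (X ω)) ∂μ

/-- Conditional mutual information (in nats)
`I(X; Y | Z) = 𝔼_Z [ D_KL(P_{XY|Z} ‖ P_{X|Z} ⊗ P_{Y|Z}) ]`. -/
def condMutualInfo {Ω α β γ : Type*} [MeasurableSpace Ω]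
    [MeasurableSpace α] [StandardBorelSpace α] [Nonempty α]
    [MeasurableSpace β] [StandardBorelSpace β] [Nonempty β] [MeasurableSpace γ]
    (μ : Measure Ω) [IsFiniteMeasure μ] (X : Ω → α) (Y : Ω → β) (Z : Ω → γ) : ℝ≥0∞ :=
  ∫⁻ z, InformationTheory.klDiv (condDistrib (fun ω => (X ω, Y ω)) Z μ z)
    ((condDistrib X Z μ z).prod (condDistrib Y Z μ z)) ∂(μ.map Z)

/-! ### Two-layer hierarchical sampling, dependent on the position

There are `K` first-layer nodes (clients). The distribution `μ₁ᵏ` of client `k` is drawn from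
`D k`, a law on the set of distributions over `𝒵` that may depend on the position `k`. Given
`μ₁ᵏ`, the `n` data points of client `k` are drawn independently from `μ₁ᵏ`. -/

section Sampling

variable {𝒵 : Type*} [MeasurableSpace 𝒵] {K : ℕ}

/-- The sampling in which the distribution of client `k` is the deterministic `P k`. -/
def deterministicLayer (P : Fin K → ProbabilityMeasure 𝒵) (k : Fin K) :
    Measure (ProbabilityMeasure 𝒵) :=
  Measure.dirac (P k)

instance (P : Fin K → ProbabilityMeasure 𝒵) (k : Fin K) :
    IsProbabilityMeasure (deterministicLayer P k) :=
  inferInstanceAs (IsProbabilityMeasure (Measure.dirac (P k)))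

variable (D : Fin K → Measure (ProbabilityMeasure 𝒵)) (n : ℕ)

/-- Law of the data (the leaves of the tree). -/
def dataLaw : Measure (Fin K → Fin n → 𝒵) :=
  Measure.pi fun k => (kernelPi fun _ : Fin n => evalKernel 𝒵) ∘ₘ (D k)

/-- Population risk: the expected loss at a test point sampled through the tree. -/
def popRisk {𝒲 : Type*} (ℓ : 𝒲 → 𝒵 → ℝ) (w : 𝒲) : ℝ :=
  (1 / (K : ℝ)) * ∑ k, ∫ p, ∫ z, ℓ w z ∂(p : Measure 𝒵) ∂(D k)

variable {n}

/-- Empirical risk. -/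
def empRisk {𝒲 : Type*} (ℓ : 𝒲 → 𝒵 → ℝ) (w : 𝒲) (s : Fin K → Fin n → 𝒵) : ℝ :=
  (1 / ((K : ℝ) * n)) * ∑ k, ∑ j, ℓ w (s k j)

/-- Expected generalization error of the learning algorithm `alg = P_{W | data}`. -/
def genError {𝒲 : Type*} [MeasurableSpace 𝒲] (alg : Kernel (Fin K → Fin n → 𝒵) 𝒲)
    (ℓ : 𝒲 → 𝒵 → ℝ) : ℝ :=
  ∫ s, ∫ w, (popRisk D ℓ w - empRisk ℓ w s) ∂(alg s) ∂(dataLaw D n)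

end Sampling

/-! ### Supersample -/

/-- A node of the supersample: a pair of candidates together with the selecting variable. -/
abbrev SuperNode (Y : Type*) := (Fin 2 → Y) × Fin 2

/-- The selected candidate. -/
def SuperNode.selected {Y : Type*} (x : SuperNode Y) : Y := x.1 x.2

lemma measurable_selected {Y : Type*} [MeasurableSpace Y] :
    Measurable (SuperNode.selected : SuperNode Y → Y) :=
  measurable_from_prod_countable_left fun u => measurable_pi_apply u

/-- Given `x`, draw two independent candidates from `κ x` and an independent uniform selector. -/
def superKernel {X Y : Type*} [MeasurableSpace X] [MeasurableSpace Y]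
    (κ : Kernel X Y) [IsMarkovKernel κ] : Kernel X (SuperNode Y) :=
  (kernelPi fun _ : Fin 2 => κ) ×ₖ Kernel.const X (uniformOn (Set.univ : Set (Fin 2)))

instance : IsProbabilityMeasure (uniformOn (Set.univ : Set (Fin 2))) :=
  isProbabilityMeasure_uniformOn Set.finite_univ Set.univ_nonempty

instance {X Y : Type*} [MeasurableSpace X] [MeasurableSpace Y]
    (κ : Kernel X Y) [IsMarkovKernel κ] : IsMarkovKernel (superKernel κ) := by
  unfold superKernel; infer_instance

/-- The supersample of the whole tree: for each client `k` the first-layer node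
`(μ̃₁ᵏ, U₁ᵏ)` and its children `(μ̃₂ᵏʲ, U₂ᵏʲ)`, `j = 1, …, n`. -/
abbrev SuperTree (𝒵 : Type*) [MeasurableSpace 𝒵] (K n : ℕ) :=
  Fin K → SuperNode (ProbabilityMeasure 𝒵) × (Fin n → SuperNode 𝒵)

section Supersample

variable {𝒵 : Type*} [MeasurableSpace 𝒵] {K n : ℕ}

/-- The data set on which the algorithm is trained: the selected leaves. -/
def SuperTree.data (t : SuperTree 𝒵 K n) : Fin K → Fin n → 𝒵 :=
  fun k j => ((t k).2 j).selected

lemma measurable_data : Measurable (SuperTree.data : SuperTree 𝒵 K n → _) := by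
  refine measurable_pi_lambda _ fun k => measurable_pi_lambda _ fun j => ?_
  exact measurable_selected.comp
    ((measurable_pi_apply j).comp (measurable_snd.comp (measurable_pi_apply k)))

variable (D : Fin K → Measure (ProbabilityMeasure 𝒵)) [∀ k, IsProbabilityMeasure (D k)]

/-- Law of the supersample. The children of a first-layer node are drawn from its selected
candidate. -/
def superTreeLaw (n : ℕ) : Measure (SuperTree 𝒵 K n) :=
  Measure.pi fun k =>
    ((Measure.pi fun _ : Fin 2 => D k).prod (uniformOn (Set.univ : Set (Fin 2)))) ⊗ₘ
      ((kernelPi fun _ : Fin n => superKernel (evalKernel 𝒵)).comap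
        SuperNode.selected measurable_selected)

instance (n : ℕ) : IsProbabilityMeasure (superTreeLaw D n) := by
  unfold superTreeLaw; infer_instance

/-- Joint law of the supersample and of the output of the algorithm trained on the selected
data. -/
def trainingLaw {𝒪 : Type*} [MeasurableSpace 𝒪] (alg : Kernel (Fin K → Fin n → 𝒵) 𝒪)
    [IsMarkovKernel alg] : Measure (SuperTree 𝒵 K n × 𝒪) :=
  superTreeLaw D n ⊗ₘ alg.comap SuperTree.data measurable_data

instance {𝒪 : Type*} [MeasurableSpace 𝒪] (alg : Kernel (Fin K → Fin n → 𝒵) 𝒪)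
    [IsMarkovKernel alg] : IsProbabilityMeasure (trainingLaw D alg) := by
  unfold trainingLaw; infer_instance

/-- The Wasserstein bound for the tree of depth two,
`2 C ∑_{l=1}^{2} (1 / N_l) ∑_{i_{1:l}} 𝔼 𝕎(P_{W | μ̃_l, U_l}, P_{W | μ̃_l})`,
where `N₁ = K`, `N₂ = K n` and `C` is the Lipschitz constant of the loss with respect
to `ρ`. -/
def wassersteinBound {𝒲 : Type*} [MeasurableSpace 𝒲] [StandardBorelSpace 𝒲] [Nonempty 𝒲]
    (ρ : 𝒲 → 𝒲 → ℝ) (C : ℝ) (alg : Kernel (Fin K → Fin n → 𝒵) 𝒲) [IsMarkovKernel alg] :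
    ℝ≥0∞ :=
  2 * ENNReal.ofReal C *
    ((1 / (K : ℝ≥0∞)) * ∑ k, expectedWasserstein ρ (trainingLaw D alg) Prod.snd
        (fun ω => (ω.1 k).1.1) (fun ω => (ω.1 k).1.2) +
      (1 / ((K : ℝ≥0∞) * n)) * ∑ k, ∑ j, expectedWasserstein ρ (trainingLaw D alg) Prod.snd
        (fun ω => ((ω.1 k).2 j).1) (fun ω => ((ω.1 k).2 j).2))

end Supersample

/-! ### One-round federated algorithms -/

section Federated

variable {𝒵 𝒲 : Type*} [MeasurableSpace 𝒵] [MeasurableSpace 𝒲] {K n : ℕ}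

/-- Each client `k` computes a local hypothesis `W_k` from its own data through the kernel `A k`,
independently of the other clients, and the server aggregates `(W_1, …, W_K)` to `W` through the
kernel `B`. The output is `((W_1, …, W_K), W)`. -/
def federatedKernel (A : Fin K → Kernel (Fin n → 𝒵) 𝒲) [∀ k, IsMarkovKernel (A k)]
    (B : Kernel (Fin K → 𝒲) 𝒲) : Kernel (Fin K → Fin n → 𝒵) ((Fin K → 𝒲) × 𝒲) :=
  (kernelPi fun k => (A k).comap (fun s : Fin K → Fin n → 𝒵 => s k) (measurable_pi_apply k)) ⊗ₖ
    Kernel.prodMkLeft (Fin K → Fin n → 𝒵) B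

instance (A : Fin K → Kernel (Fin n → 𝒵) 𝒲) [∀ k, IsMarkovKernel (A k)]
    (B : Kernel (Fin K → 𝒲) 𝒲) [IsMarkovKernel B] : IsMarkovKernel (federatedKernel A B) := by
  unfold federatedKernel; infer_instance

/-- `I(W_k; J_k | Z̃_k)`, where `W_k` is the local hypothesis of client `k`, `Z̃_k` collects
the pairs of data points of client `k` in the supersample and `J_k` the corresponding
selectors. -/
def clientCMI [StandardBorelSpace 𝒲] [Nonempty 𝒲]
    (D : Fin K → Measure (ProbabilityMeasure 𝒵)) [∀ k, IsProbabilityMeasure (D k)]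
    (A : Fin K → Kernel (Fin n → 𝒵) 𝒲) [∀ k, IsMarkovKernel (A k)]
    (B : Kernel (Fin K → 𝒲) 𝒲) [IsMarkovKernel B] (k : Fin K) : ℝ≥0∞ :=
  condMutualInfo (trainingLaw D (federatedKernel A B))
    (fun ω => ω.2.1 k) (fun ω j => ((ω.1 k).2 j).2) (fun ω j => ((ω.1 k).2 j).1)

end Federated

end HierFL

end

noncomputable section

namespace HierFL

/-! First inequality. The unselected point of leaf (k, j) is a draw from P_k independent of all the
training data (`map_data_unselected`), so gen is minus the mean over leaves of E[ℓ(W, selected) -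
ℓ(W, unselected)] (`genError_deterministicLayer`). Drawing W afresh from P_{W|Z̃} makes it blind to
the selector, so the loss at the selected point averages to the mean of the two candidate losses.
Hence each term is twice a mean difference of integrals of ℓ under P_{W|Z̃,J} and P_{W|Z̃}, which
the easy half of Kantorovich duality bounds (`ofReal_abs_integral_sub_flip_le`). The first-layer
terms are only nonnegative extras here.

Second inequality. Both first-layer candidates equal P_k, so W is independent of the first layer and
those terms vanish (`expectedWasserstein_first_eq_zero`). For the discrete metric, 𝕎 is total
variation and is attained on a Hahn set. Chosen measurably, these sets give a test function |h| ≤ 1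
with E𝕎 ≤ ½ E[s(J) h(Z̃, W)], where s is the sign of the selector (`exists_expectedWasserstein_le`).

Averaging out the other clients and the server turns h(Z̃, W) into a test of the local hypothesis
W_k, still bounded by 1 and with the same correlation e_{kj} with the sign
(`exists_local_test_function`); this plays the role of data processing.

The n selectors of a client are then treated jointly: Donsker–Varadhan with the exponent c Σ_j
s(J_j) h_j - nc²/2, normalized by cosh x ≤ exp(x²/2), gives c Σ_j e_{kj} - nc²/2 ≤ I(W_k; J_k |
Z̃_k) (`ofReal_sum_integral_le_condMutualInfo`). Summing over clients with the common value c equal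
to the mean of the e_{kj} yields the square root (`ofReal_mean_le_rpow`). -/

lemma ofReal_integral_le_lintegral_ofReal {α : Type*} [MeasurableSpace α] {μ : Measure α}
    {f : α → ℝ} : ENNReal.ofReal (∫ x, f x ∂μ) ≤ ∫⁻ x, ENNReal.ofReal (f x) ∂μ := by
  by_cases hf : Integrable f μ
  · rw [integral_eq_lintegral_pos_part_sub_lintegral_neg_part hf]
    refine (ENNReal.ofReal_le_ofReal (sub_le_self _ ENNReal.toReal_nonneg)).trans ?_
    exact ENNReal.ofReal_toReal_le
  -- A non-integrable function has Bochner integral 0, so the bound needs no integrability.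
  · simp [integral_undef hf]

/-! ### Wasserstein distance for the discrete metric: duality and maximal coupling -/

section Coupling

variable {𝒲 : Type*} [MeasurableSpace 𝒲] [StandardBorelSpace 𝒲]

lemma measurable_ofReal_discreteDist :
    Measurable fun x : 𝒲 × 𝒲 => ENNReal.ofReal (discreteDist x.1 x.2) := by
  refine ENNReal.measurable_ofReal.comp ?_
  unfold discreteDist
  exact Measurable.ite measurableSet_diagonal measurable_const measurable_const

lemma wasserstein_discreteDist_self (P : Measure 𝒲) : wasserstein discreteDist P P = 0 := by
  refine le_antisymm ?_ zero_le
  have hd : Measurable fun w : 𝒲 => (w, w) := measurable_id.prodMk measurable_id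
  refine iInf_le_of_le (P.map fun w => (w, w)) (iInf₂_le_of_le ?_ ?_ ?_)
  · rw [Measure.map_map measurable_fst hd]; exact Measure.map_id
  · rw [Measure.map_map measurable_snd hd]; exact Measure.map_id
  · rw [lintegral_map measurable_ofReal_discreteDist hd]
    simp [discreteDist]

/-- Easy half of Kantorovich duality for the discrete metric. -/
lemma ofReal_abs_integral_sub_le_wasserstein {P Q : Measure 𝒲}
    [IsProbabilityMeasure P] [IsProbabilityMeasure Q] {f : 𝒲 → ℝ} (hf : Measurable f) {a b : ℝ}
    (hab : ∀ w, f w ∈ Set.Icc a b) :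
    ENNReal.ofReal |∫ w, f w ∂P - ∫ w, f w ∂Q| ≤
      ENNReal.ofReal (b - a) * wasserstein discreteDist P Q := by
  -- A zero factor does not pass inside an infimum over a possibly false condition, since 0 * ⊤ = 0;
  -- in that case `f` is constant.
  rcases eq_or_ne (ENNReal.ofReal (b - a)) 0 with h0 | h0
  · have hba : b ≤ a := by simpa using h0
    have hfa : f = fun _ => a := funext fun w => le_antisymm ((hab w).2.trans hba) (hab w).1
    simp [hfa]
  unfold wasserstein
  rw [ENNReal.mul_iInf_of_ne h0 ENNReal.ofReal_ne_top]
  refine le_iInf fun π => ?_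
  rw [ENNReal.mul_iInf_of_ne h0 ENNReal.ofReal_ne_top]
  refine le_iInf fun hP => ?_
  rw [ENNReal.mul_iInf_of_ne h0 ENNReal.ofReal_ne_top]
  refine le_iInf fun hQ => ?_
  have : IsProbabilityMeasure π := by
    constructor
    rw [← Set.preimage_univ (f := Prod.fst), ← Measure.map_apply measurable_fst .univ, hP]
    exact measure_univ
  have hi : ∀ g : 𝒲 × 𝒲 → 𝒲, Measurable g → Integrable (fun x => f (g x)) π := fun g hg =>
    Integrable.of_mem_Icc a b (hf.comp hg).aemeasurable (ae_of_all _ fun x => hab _)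
  rw [← hP, ← hQ, integral_map measurable_fst.aemeasurable hf.aestronglyMeasurable,
    integral_map measurable_snd.aemeasurable hf.aestronglyMeasurable,
    ← integral_sub (hi _ measurable_fst) (hi _ measurable_snd),
    ← lintegral_const_mul _ measurable_ofReal_discreteDist]
  rw [← Real.enorm_eq_ofReal_abs]
  refine (enorm_integral_le_lintegral_enorm _).trans (lintegral_mono fun x => ?_)
  rw [Real.enorm_eq_ofReal_abs]
  unfold discreteDist
  split_ifs with h
  · simp [h]
  · rw [ENNReal.ofReal_one, mul_one]
    refine ENNReal.ofReal_le_ofReal ?_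
    have h1 := hab x.1
    have h2 := hab x.2
    rw [abs_le]
    constructor <;> linarith [h1.1, h1.2, h2.1, h2.2]

/-- Maximal coupling, from a Hahn set. -/
lemma wasserstein_discreteDist_le_of_hahn {P Q : Measure 𝒲}
    [IsProbabilityMeasure P] [IsProbabilityMeasure Q] {s : Set 𝒲} (hs : MeasurableSet s)
    (h1 : Q.restrict s ≤ P.restrict s) (h2 : P.restrict sᶜ ≤ Q.restrict sᶜ) :
    wasserstein discreteDist P Q ≤ P s - Q s := by
  -- `M` is the common mass of P and Q; `α` and `β` are the excesses of P and of Q, of equal total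
  -- mass `c`.
  set α := P.restrict s - Q.restrict s with hα
  set β := Q.restrict sᶜ - P.restrict sᶜ with hβ
  set M := Q.restrict s + P.restrict sᶜ with hM
  have hP : M + α = P := by
    have : α + Q.restrict s = P.restrict s := Measure.sub_add_cancel_of_le h1
    rw [hM, add_right_comm, add_comm (Q.restrict s), this, Measure.restrict_add_restrict_compl hs]
  have hQ : M + β = Q := by
    have : β + P.restrict sᶜ = Q.restrict sᶜ := Measure.sub_add_cancel_of_le h2
    rw [hM, add_assoc, add_comm (P.restrict sᶜ), this, Measure.restrict_add_restrict_compl hs]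
  have hfin : IsFiniteMeasure M := by rw [hM]; infer_instance
  have hfa : IsFiniteMeasure α := ⟨(Measure.sub_le _).trans_lt (measure_lt_top _ _)⟩
  have hfb : IsFiniteMeasure β := ⟨(Measure.sub_le _).trans_lt (measure_lt_top _ _)⟩
  have hα1 : α Set.univ = P s - Q s := by
    rw [hα, Measure.sub_apply .univ h1]; simp
  have hαβ : α Set.univ = β Set.univ := by
    have e1 := congrArg (fun m => m Set.univ) hP
    have e2 := congrArg (fun m => m Set.univ) hQ
    simp only [Measure.add_apply, measure_univ] at e1 e2
    exact (ENNReal.add_right_inj (measure_ne_top M Set.univ)).1 (e1.trans e2.symm)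
  rw [← hα1]
  set c := α Set.univ with hc
  have hctop : c ≠ ⊤ := measure_ne_top _ _
  have hd : Measurable fun w : 𝒲 => (w, w) := measurable_id.prodMk measurable_id
  -- The common mass stays on the diagonal at no cost, and the excesses are coupled independently at
  -- cost at most `c`. If `c = 0` the factor `c⁻¹ = ⊤` is harmless, because both excesses vanish.
  refine iInf_le_of_le (M.map (fun w => (w, w)) + c⁻¹ • α.prod β) (iInf₂_le_of_le ?_ ?_ ?_)
  · rw [Measure.map_add _ _ measurable_fst, Measure.map_map measurable_fst hd, Measure.map_smul,
      Measure.map_fst_prod, ← hαβ]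
    change M.map id + _ = _
    rw [Measure.map_id, smul_smul]
    rcases eq_or_ne c 0 with h0 | h0
    · have : α = 0 := Measure.measure_univ_eq_zero.1 h0
      rw [← hP, this, smul_zero]
    · rw [ENNReal.inv_mul_cancel h0 hctop, one_smul, hP]
  · rw [Measure.map_add _ _ measurable_snd, Measure.map_map measurable_snd hd, Measure.map_smul,
      Measure.map_snd_prod]
    change M.map id + _ = _
    rw [Measure.map_id, smul_smul]
    rcases eq_or_ne c 0 with h0 | h0
    · have : β = 0 := Measure.measure_univ_eq_zero.1 (hαβ ▸ h0)
      rw [← hQ, this, smul_zero]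
    · rw [ENNReal.inv_mul_cancel h0 hctop, one_smul, hQ]
  · rw [lintegral_add_measure, lintegral_map measurable_ofReal_discreteDist hd,
      lintegral_smul_measure]
    have : ∫⁻ x, ENNReal.ofReal (discreteDist x.1 x.2) ∂(α.prod β) ≤ c * c := by
      calc _ ≤ ∫⁻ x, 1 ∂(α.prod β) := lintegral_mono fun x => by
            unfold discreteDist; split_ifs <;> simp
        _ = c * c := by
            rw [lintegral_one, ← Set.univ_prod_univ, Measure.prod_prod, ← hαβ]
    calc _ = c⁻¹ • ∫⁻ x, ENNReal.ofReal (discreteDist x.1 x.2) ∂(α.prod β) := by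
          simp [discreteDist]
      _ ≤ c⁻¹ * (c * c) := by rw [smul_eq_mul]; gcongr
      _ = (c⁻¹ * c) * c := by ring
      _ ≤ 1 * c := by gcongr; exact ENNReal.inv_mul_le_one c
      _ = c := one_mul c

/-- A jointly measurable family of Hahn sets for two Markov kernels. -/
lemma exists_measurableSet_wasserstein_le {X : Type*} [MeasurableSpace X]
    (κ η : Kernel X 𝒲) [IsMarkovKernel κ] [IsMarkovKernel η] :
    ∃ S : Set (X × 𝒲), MeasurableSet S ∧ ∀ x,
      (η x).real (Prod.mk x ⁻¹' S) ≤ (κ x).real (Prod.mk x ⁻¹' S) ∧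
      wasserstein discreteDist (κ x) (η x) ≤
        ENNReal.ofReal ((κ x).real (Prod.mk x ⁻¹' S) - (η x).real (Prod.mk x ⁻¹' S)) := by
  -- A jointly measurable density of κ with respect to κ + η. It is at least 1/2 where κ dominates
  -- η, so thresholding at 1/2 gives the Hahn sets for all x at once.
  let r : X → 𝒲 → ℝ := Kernel.rnDerivAux κ (κ + η)
  have hr : Measurable fun p : X × 𝒲 => r p.1 p.2 := Kernel.measurable_rnDerivAux κ (κ + η)
  have hle : κ ≤ κ + η := fun x => by
    rw [add_apply]; exact Measure.le_add_right le_rfl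
  have key : ∀ x t, MeasurableSet t →
      ∫⁻ w in t, ENNReal.ofReal (r x w) ∂(κ x + η x) = κ x t := fun x t ht => by
    have := Kernel.setLIntegral_rnDerivAux κ η x ht
    rwa [add_apply] at this
  have hhalf : ENNReal.ofReal (1 / 2) = 2⁻¹ := by
    rw [one_div, ENNReal.ofReal_inv_of_pos two_pos]; simp
  refine ⟨{p | 1 / 2 ≤ r p.1 p.2}, measurableSet_le measurable_const hr, fun x => ?_⟩
  have hs : MeasurableSet (Prod.mk x ⁻¹' {p : X × 𝒲 | 1 / 2 ≤ r p.1 p.2}) :=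
    measurable_prodMk_left (measurableSet_le measurable_const hr)
  set s := Prod.mk x ⁻¹' {p : X × 𝒲 | 1 / 2 ≤ r p.1 p.2} with hsdef
  have h1 : (η x).restrict s ≤ (κ x).restrict s := by
    refine Measure.le_iff.2 fun t ht => ?_
    rw [Measure.restrict_apply ht, Measure.restrict_apply ht]
    have hts := ht.inter hs
    have h : 2⁻¹ * ((κ x + η x) (t ∩ s)) ≤ κ x (t ∩ s) := by
      rw [← key x _ hts, ← setLIntegral_const]
      refine setLIntegral_mono' hts fun w hw => ?_
      rw [← hhalf]
      exact ENNReal.ofReal_le_ofReal hw.2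
    rw [ENNReal.inv_mul_le_iff two_ne_zero ENNReal.ofNat_ne_top, two_mul,
      Measure.add_apply] at h
    exact (ENNReal.add_le_add_iff_left (measure_ne_top _ _)).1 h
  have h2 : (κ x).restrict sᶜ ≤ (η x).restrict sᶜ := by
    refine Measure.le_iff.2 fun t ht => ?_
    rw [Measure.restrict_apply ht, Measure.restrict_apply ht]
    have hts := ht.inter hs.compl
    have h : κ x (t ∩ sᶜ) ≤ 2⁻¹ * ((κ x + η x) (t ∩ sᶜ)) := by
      rw [← key x _ hts, ← setLIntegral_const]
      refine setLIntegral_mono' hts fun w hw => ?_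
      rw [← hhalf]
      exact ENNReal.ofReal_le_ofReal (not_le.1 (show ¬ 1 / 2 ≤ r x w from hw.2)).le
    rw [mul_comm, ← div_eq_mul_inv, ENNReal.le_div_iff_mul_le (by simp) (by simp), mul_two,
      Measure.add_apply] at h
    exact (ENNReal.add_le_add_iff_left (measure_ne_top _ _)).1 h
  have h3 : η x s ≤ κ x s := by simpa using Measure.le_iff.1 h1 Set.univ .univ
  refine ⟨ENNReal.toReal_mono (measure_ne_top _ _) h3,
    (wasserstein_discreteDist_le_of_hahn hs h1 h2).trans_eq ?_⟩
  rw [ENNReal.ofReal_sub _ measureReal_nonneg, ofReal_measureReal, ofReal_measureReal]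

end Coupling

/-! ### Donsker–Varadhan inequality -/

section DonskerVaradhan
open InformationTheory

/-- Fenchel–Young: the convex conjugate of `klFun` on the half-line is exp y - 1. For x > 0 equality
holds at y = log x, and the inequality is t + 1 ≤ exp t at t = y - log x. -/
lemma mul_sub_exp_add_one_le_klFun {x : ℝ} (hx : 0 ≤ x) (y : ℝ) :
    x * y - Real.exp y + 1 ≤ klFun x := by
  rw [klFun_apply]
  rcases hx.eq_or_lt with rfl | hx
  · simp [(Real.exp_pos y).le]
  · have h := Real.add_one_le_exp (y - Real.log x)
    have h2 : Real.exp y = x * Real.exp (y - Real.log x) := by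
      rw [Real.exp_sub, Real.exp_log hx]; field_simp
    rw [h2]
    nlinarith [mul_le_mul_of_nonneg_left h hx.le]

/-- A form of the Donsker–Varadhan inequality. -/
lemma ofReal_integral_le_klDiv {α : Type*} [MeasurableSpace α] (μ ν : Measure α)
    [IsProbabilityMeasure μ] [IsProbabilityMeasure ν] {f : α → ℝ} (hf : Measurable f) {C : ℝ}
    (hC : ∀ x, |f x| ≤ C) (hexp : ∫ x, Real.exp (f x) ∂ν ≤ 1) :
    ENNReal.ofReal (∫ x, f x ∂μ) ≤ klDiv μ ν := by
  by_cases hac : μ ≪ ν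
  swap
  · rw [klDiv_of_not_ac hac]; exact le_top
  rw [klDiv_eq_lintegral_klFun_of_ac hac]
  have hint : Integrable (fun x => (μ.rnDeriv ν x).toReal * f x) ν := by
    refine (Measure.integrable_toReal_rnDeriv (μ := μ) (ν := ν)).mul_bdd (c := C)
      hf.aestronglyMeasurable (ae_of_all _ fun x => by simpa using hC x)
  have hE : Integrable (fun x => Real.exp (f x)) ν := by
    refine Integrable.of_bound (hf.exp).aestronglyMeasurable (Real.exp C)
      (ae_of_all _ fun x => ?_)
    rw [Real.norm_eq_abs, Real.abs_exp]
    exact Real.exp_le_exp.2 ((le_abs_self _).trans (hC x))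
  -- Fenchel–Young is integrated with x the density of μ; the leftover 1 - ∫ exp f ∂ν is nonnegative
  -- by `hexp`.
  calc ENNReal.ofReal (∫ x, f x ∂μ)
      ≤ ENNReal.ofReal (∫ x, ((μ.rnDeriv ν x).toReal * f x - Real.exp (f x) + 1) ∂ν) := by
        refine ENNReal.ofReal_le_ofReal ?_
        rw [integral_add (f := fun x => (μ.rnDeriv ν x).toReal * f x - Real.exp (f x))
          (hint.sub hE) (integrable_const _), integral_sub hint hE]
        have := integral_rnDeriv_smul hac (f := f)
        simp only [smul_eq_mul] at this
        rw [this]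
        simp only [integral_const, probReal_univ, smul_eq_mul, mul_one]
        linarith
    _ ≤ ∫⁻ x, ENNReal.ofReal ((μ.rnDeriv ν x).toReal * f x - Real.exp (f x) + 1) ∂ν :=
        ofReal_integral_le_lintegral_ofReal
    _ ≤ _ := lintegral_mono fun x =>
        ENNReal.ofReal_le_ofReal (mul_sub_exp_add_one_le_klFun ENNReal.toReal_nonneg _)

end DonskerVaradhan

/-! ### Uniform selectors and their signs -/

section Selector

/-- The law of a uniform selector. -/
abbrev coin : Measure (Fin 2) := uniformOn (Set.univ : Set (Fin 2))

/-- The sign attached to a selector. -/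
def selSign (u : Fin 2) : ℝ := if u = 0 then 1 else -1

lemma measurable_selSign : Measurable selSign := measurable_of_countable _

lemma abs_selSign (u : Fin 2) : |selSign u| = 1 := by
  unfold selSign; split_ifs <;> simp

lemma coin_singleton (u : Fin 2) : coin {u} = 2⁻¹ := by
  rw [uniformOn_univ, Measure.count_singleton]
  simp

lemma integral_coin (f : Fin 2 → ℝ) : ∫ u, f u ∂coin = (f 0 + f 1) / 2 := by
  rw [integral_fintype .of_finite, Fin.sum_univ_two]
  simp only [measureReal_def, coin_singleton, smul_eq_mul, ENNReal.toReal_inv,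
    ENNReal.toReal_ofNat]
  ring

/-- In `Fin 2`, u + 1 is the other selector value. -/
lemma add_flip (f : Fin 2 → ℝ) (u : Fin 2) : f u + f (u + 1) = f 0 + f 1 := by
  fin_cases u
  · rfl
  · exact add_comm _ _

lemma sub_flip (f : Fin 2 → ℝ) (u : Fin 2) : f u - f (u + 1) = selSign u * (f 0 - f 1) := by
  fin_cases u
  · change f 0 - f 1 = selSign 0 * _
    simp [selSign]
  · change f 1 - f 0 = selSign 1 * _
    simp [selSign]

end Selector

/-! ### One supersample node: swapping candidates and testing the selector -/

section OneNode

variable {Ω 𝒳 𝒲 : Type*} [MeasurableSpace Ω] [MeasurableSpace 𝒳]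
  [MeasurableSpace 𝒲] [StandardBorelSpace 𝒲] [Nonempty 𝒲]
  {μ : Measure Ω} [IsProbabilityMeasure μ] {W : Ω → 𝒲} {X : Ω → 𝒳} {U : Ω → Fin 2}

lemma integral_integral_condDistrib_of_bdd {𝒴 : Type*} [MeasurableSpace 𝒴] {Y : Ω → 𝒴}
    (hW : Measurable W) (hY : Measurable Y) {φ : 𝒴 → 𝒲 → ℝ}
    (hφ : Measurable (Function.uncurry φ)) {C : ℝ} (hC : ∀ y w, |φ y w| ≤ C) :
    ∫ ω, ∫ w, φ (Y ω) w ∂(condDistrib W Y μ (Y ω)) ∂μ = ∫ ω, φ (Y ω) (W ω) ∂μ := by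
  have hm : StronglyMeasurable fun y => ∫ w, φ y w ∂(condDistrib W Y μ y) :=
    StronglyMeasurable.integral_kernel_prod_right hφ.stronglyMeasurable
  have : IsProbabilityMeasure (μ.map Y) := Measure.isProbabilityMeasure_map hY.aemeasurable
  rw [← integral_map (f := fun y => ∫ w, φ y w ∂(condDistrib W Y μ y)) hY.aemeasurable
    hm.aestronglyMeasurable]
  have := Measure.integral_compProd (μ := μ.map Y) (κ := condDistrib W Y μ)
    (f := Function.uncurry φ) (Integrable.of_bound hφ.aestronglyMeasurable C
      (ae_of_all _ fun p => hC p.1 p.2))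
  simp only [Function.uncurry_apply_pair] at this
  rw [← this, compProd_map_condDistrib hW.aemeasurable,
    integral_map (hY.prodMk hW).aemeasurable hφ.aestronglyMeasurable]
  rfl

lemma abs_integral_le_of_abs_le {α : Type*} [MeasurableSpace α] {ν : Measure α}
    [IsProbabilityMeasure ν] {f : α → ℝ} {C : ℝ} (hC : ∀ x, |f x| ≤ C) : |∫ x, f x ∂ν| ≤ C := by
  have := norm_integral_le_of_norm_le_const (μ := ν) (f := f) (ae_of_all _ hC)
  simpa using this

/-- If the selector is uniform and independent of `X`, replacing `W` by a fresh draw from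
`P_{W | X}` amounts to averaging over the selector. -/
lemma integral_condDistrib_of_uniform (hW : Measurable W) (hX : Measurable X) (hU : Measurable U)
    (hXU : μ.map (fun ω => (X ω, U ω)) = (μ.map X).prod coin) {φ : 𝒳 × Fin 2 → 𝒲 → ℝ}
    (hφ : Measurable (Function.uncurry φ)) {C : ℝ} (hC : ∀ y w, |φ y w| ≤ C) :
    ∫ ω, ∫ w, φ (X ω, U ω) w ∂(condDistrib W X μ (X ω)) ∂μ =
      ∫ ω, (φ (X ω, 0) (W ω) + φ (X ω, 1) (W ω)) / 2 ∂μ := by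
  have hm : StronglyMeasurable fun y : 𝒳 × Fin 2 => ∫ w, φ y w ∂(condDistrib W X μ y.1) :=
    StronglyMeasurable.integral_kernel_prod_right (κ := (condDistrib W X μ).comap Prod.fst
      measurable_fst) hφ.stronglyMeasurable
  have hφu : ∀ u, Measurable fun p : 𝒳 × 𝒲 => φ (p.1, u) p.2 := fun u =>
    hφ.comp ((measurable_fst.prodMk measurable_const).prodMk measurable_snd)
  have hi : ∀ u, Integrable (fun x => ∫ w, φ (x, u) w ∂(condDistrib W X μ x)) (μ.map X) :=
    fun u => by
      have : IsProbabilityMeasure (μ.map X) := Measure.isProbabilityMeasure_map hX.aemeasurable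
      exact Integrable.of_bound (hm.comp_measurable
        (measurable_id.prodMk measurable_const)).aestronglyMeasurable C
        (ae_of_all _ fun x => abs_integral_le_of_abs_le fun w => hC _ _)
  have hi' : ∀ u, Integrable (fun ω => φ (X ω, u) (W ω)) μ := fun u =>
    Integrable.of_bound ((hφu u).comp (hX.prodMk hW)).aestronglyMeasurable C
      (ae_of_all _ fun ω => hC _ _)
  have hu : ∀ u, ∫ x, ∫ w, φ (x, u) w ∂(condDistrib W X μ x) ∂(μ.map X) =
      ∫ ω, φ (X ω, u) (W ω) ∂μ := fun u => by
    rw [integral_map hX.aemeasurable (hi u).aestronglyMeasurable]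
    exact integral_integral_condDistrib_of_bdd (φ := fun x w => φ (x, u) w) hW hX (hφu u)
      fun x w => hC _ _
  have : IsProbabilityMeasure (μ.map X) := Measure.isProbabilityMeasure_map hX.aemeasurable
  rw [← integral_map (f := fun y : 𝒳 × Fin 2 => ∫ w, φ y w ∂(condDistrib W X μ y.1))
    (hX.prodMk hU).aemeasurable hm.aestronglyMeasurable, hXU,
    integral_prod _ (Integrable.of_bound hm.aestronglyMeasurable C
      (ae_of_all _ fun y => abs_integral_le_of_abs_le fun w => hC _ _))]
  simp_rw [integral_coin]
  rw [integral_div, integral_add (hi 0) (hi 1), hu, hu, integral_div,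
    integral_add (hi' 0) (hi' 1)]

/-- The effect on a bounded function of swapping the candidates is at most the expected
Wasserstein distance. -/
lemma ofReal_abs_integral_sub_flip_le (hW : Measurable W) (hX : Measurable X) (hU : Measurable U)
    (hXU : μ.map (fun ω => (X ω, U ω)) = (μ.map X).prod coin) {φ : 𝒳 × Fin 2 → 𝒲 → ℝ}
    (hφ : Measurable (Function.uncurry φ)) {a b : ℝ} (hab : ∀ y w, φ y w ∈ Set.Icc a b) :
    ENNReal.ofReal |∫ ω, (φ (X ω, U ω) (W ω) - φ (X ω, U ω + 1) (W ω)) ∂μ| ≤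
      2 * ENNReal.ofReal (b - a) * expectedWasserstein discreteDist μ W X U := by
  have hC : ∀ y w, |φ y w| ≤ max |a| |b| := fun y w => abs_le_max_abs_abs (hab y w).1 (hab y w).2
  set C := max |a| |b|
  have hY := hX.prodMk hU
  have hY' : Measurable fun ω => (X ω, U ω + 1) :=
    hX.prodMk ((measurable_of_countable fun u : Fin 2 => u + 1).comp hU)
  have hi : ∀ Y : Ω → 𝒳 × Fin 2, Measurable Y → Integrable (fun ω => φ (Y ω) (W ω)) μ :=
    fun Y hY => Integrable.of_bound (hφ.comp (hY.prodMk hW)).aestronglyMeasurable C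
      (ae_of_all _ fun ω => hC _ _)
  have hκ : Integrable
      (fun ω => ∫ w, φ (X ω, U ω) w ∂(condDistrib W (fun ω => (X ω, U ω)) μ (X ω, U ω))) μ :=
    Integrable.of_bound ((StronglyMeasurable.integral_kernel_prod_right
      (κ := condDistrib W (fun ω => (X ω, U ω)) μ)
      hφ.stronglyMeasurable).comp_measurable hY).aestronglyMeasurable C
      (ae_of_all _ fun ω => abs_integral_le_of_abs_le fun w => hC _ _)
  have hη : Integrable (fun ω => ∫ w, φ (X ω, U ω) w ∂(condDistrib W X μ (X ω))) μ :=
    Integrable.of_bound ((StronglyMeasurable.integral_kernel_prod_right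
      (κ := (condDistrib W X μ).comap Prod.fst measurable_fst)
      hφ.stronglyMeasurable).comp_measurable hY).aestronglyMeasurable C
      (ae_of_all _ fun ω => abs_integral_le_of_abs_le fun w => hC _ _)
  -- Under P_{W|X} the integral averages to half the sum of the two candidate values. Subtracting
  -- that from the selected value leaves half the swap difference, hence the factor 2.
  have key : ∫ ω, (φ (X ω, U ω) (W ω) - φ (X ω, U ω + 1) (W ω)) ∂μ =
      2 * ∫ ω, (∫ w, φ (X ω, U ω) w ∂(condDistrib W (fun ω => (X ω, U ω)) μ (X ω, U ω)) -
        ∫ w, φ (X ω, U ω) w ∂(condDistrib W X μ (X ω))) ∂μ := by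
    rw [integral_sub hκ hη, integral_integral_condDistrib_of_bdd hW hY hφ hC,
      integral_condDistrib_of_uniform hW hX hU hXU hφ hC]
    have : ∀ ω, (φ (X ω, 0) (W ω) + φ (X ω, 1) (W ω)) / 2 =
        (φ (X ω, U ω) (W ω) + φ (X ω, U ω + 1) (W ω)) / 2 := fun ω => by
      rw [add_flip (fun u => φ (X ω, u) (W ω))]
    simp_rw [this]
    rw [integral_div, integral_add (hi _ hY) (hi _ hY'), integral_sub (hi _ hY) (hi _ hY')]
    ring
  rw [key, abs_mul, abs_two, ENNReal.ofReal_mul two_pos.le, mul_assoc]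
  simp only [ENNReal.ofReal_ofNat]
  gcongr
  rw [← Real.enorm_eq_ofReal_abs, expectedWasserstein,
    ← lintegral_const_mul' _ _ ENNReal.ofReal_ne_top]
  refine (enorm_integral_le_lintegral_enorm _).trans (lintegral_mono fun ω => ?_)
  rw [Real.enorm_eq_ofReal_abs]
  exact ofReal_abs_integral_sub_le_wasserstein
    (hφ.comp (measurable_const.prodMk measurable_id)) (fun w => hab _ w)

/-- The expected total variation distance is attained by a test function correlated with the
sign of the selector. -/
lemma exists_expectedWasserstein_le (hW : Measurable W) (hX : Measurable X) (hU : Measurable U)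
    (hXU : μ.map (fun ω => (X ω, U ω)) = (μ.map X).prod coin) :
    ∃ h : 𝒳 → 𝒲 → ℝ, Measurable (Function.uncurry h) ∧ (∀ x w, |h x w| ≤ 1) ∧
      0 ≤ ∫ ω, selSign (U ω) * h (X ω) (W ω) ∂μ ∧
      expectedWasserstein discreteDist μ W X U ≤
        ENNReal.ofReal ((∫ ω, selSign (U ω) * h (X ω) (W ω) ∂μ) / 2) := by
  obtain ⟨S, hS, hSle⟩ := exists_measurableSet_wasserstein_le
    (condDistrib W (fun ω => (X ω, U ω)) μ) ((condDistrib W X μ).comap Prod.fst measurable_fst)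
  let φ : 𝒳 × Fin 2 → 𝒲 → ℝ := fun y w => S.indicator 1 (y, w)
  have hφ : Measurable (Function.uncurry φ) := measurable_one.indicator hS
  have hφ01 : ∀ y w, φ y w ∈ Set.Icc (0 : ℝ) 1 := fun y w => by
    by_cases h : (y, w) ∈ S <;> simp [φ, h]
  have hC : ∀ y w, |φ y w| ≤ 1 := fun y w => by
    rw [abs_of_nonneg (hφ01 y w).1]; exact (hφ01 y w).2
  have hint : ∀ (ν : Measure 𝒲) y, ν.real (Prod.mk y ⁻¹' S) = ∫ w, φ y w ∂ν := fun ν y => by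
    rw [← integral_indicator_one (measurable_prodMk_left hS)]; rfl
  have hφu : ∀ u, Measurable fun p : 𝒳 × 𝒲 => φ (p.1, u) p.2 := fun u =>
    hφ.comp ((measurable_fst.prodMk measurable_const).prodMk measurable_snd)
  -- The Hahn set depends on the selector; the difference of its two indicators is a test function
  -- of (x, w) alone.
  refine ⟨fun x w => φ (x, 0) w - φ (x, 1) w, (hφu 0).sub (hφu 1), fun x w => ?_, ?_⟩
  · have h0 := hφ01 (x, 0) w
    have h1 := hφ01 (x, 1) w
    rw [abs_le]; constructor <;> linarith [h0.1, h0.2, h1.1, h1.2]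
  have hY := hX.prodMk hU
  have hi : ∀ Y : Ω → 𝒳 × Fin 2, Measurable Y → Integrable (fun ω => φ (Y ω) (W ω)) μ :=
    fun Y hY => Integrable.of_bound (hφ.comp (hY.prodMk hW)).aestronglyMeasurable 1
      (ae_of_all _ fun ω => hC _ _)
  have hκ : Integrable
      (fun ω => ∫ w, φ (X ω, U ω) w ∂(condDistrib W (fun ω => (X ω, U ω)) μ (X ω, U ω))) μ :=
    Integrable.of_bound ((StronglyMeasurable.integral_kernel_prod_right
      (κ := condDistrib W (fun ω => (X ω, U ω)) μ)
      hφ.stronglyMeasurable).comp_measurable hY).aestronglyMeasurable 1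
      (ae_of_all _ fun ω => abs_integral_le_of_abs_le fun w => hC _ _)
  have hη : Integrable (fun ω => ∫ w, φ (X ω, U ω) w ∂(condDistrib W X μ (X ω))) μ :=
    Integrable.of_bound ((StronglyMeasurable.integral_kernel_prod_right
      (κ := (condDistrib W X μ).comap Prod.fst measurable_fst)
      hφ.stronglyMeasurable).comp_measurable hY).aestronglyMeasurable 1
      (ae_of_all _ fun ω => abs_integral_le_of_abs_le fun w => hC _ _)
  have hmean : Integrable (fun ω => (φ (X ω, 0) (W ω) + φ (X ω, 1) (W ω)) / 2) μ :=
    ((hi _ (hX.prodMk measurable_const)).add (hi _ (hX.prodMk measurable_const))).div_const 2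
  simp only [hint, Kernel.comap_apply] at hSle
  -- Pointwise, φ_U - (φ_0 + φ_1)/2 = s(U)(φ_0 - φ_1)/2.
  have heq : (∫ ω, selSign (U ω) * (φ (X ω, 0) (W ω) - φ (X ω, 1) (W ω)) ∂μ) / 2 =
      ∫ ω, (∫ w, φ (X ω, U ω) w ∂(condDistrib W (fun ω => (X ω, U ω)) μ (X ω, U ω)) -
        ∫ w, φ (X ω, U ω) w ∂(condDistrib W X μ (X ω))) ∂μ := by
    rw [integral_sub hκ hη, integral_integral_condDistrib_of_bdd hW hY hφ hC,
      integral_condDistrib_of_uniform hW hX hU hXU hφ hC, ← integral_div,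
      ← integral_sub (hi _ hY) hmean]
    refine integral_congr_ae (ae_of_all _ fun ω => ?_)
    have h1 := add_flip (fun u => φ (X ω, u) (W ω)) (U ω)
    have h2 := sub_flip (fun u => φ (X ω, u) (W ω)) (U ω)
    simp only at h1 h2 ⊢
    linarith
  have hnn : ∀ ω, 0 ≤
      ∫ w, φ (X ω, U ω) w ∂(condDistrib W (fun ω => (X ω, U ω)) μ (X ω, U ω)) -
        ∫ w, φ (X ω, U ω) w ∂(condDistrib W X μ (X ω)) :=
    fun ω => sub_nonneg.2 (hSle (X ω, U ω)).1
  constructor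
  · have h0 : 0 ≤ (∫ ω, selSign (U ω) * (φ (X ω, 0) (W ω) - φ (X ω, 1) (W ω)) ∂μ) / 2 := by
      rw [heq]; exact integral_nonneg hnn
    change 0 ≤ ∫ ω, selSign (U ω) * (φ (X ω, 0) (W ω) - φ (X ω, 1) (W ω)) ∂μ
    linarith
  · rw [heq]
    exact (lintegral_mono fun ω => (hSle (X ω, U ω)).2).trans_eq
      (ofReal_integral_eq_lintegral_ofReal (hκ.sub hη) (ae_of_all _ hnn)).symm

/-- Under independence the constant kernel disintegrates the joint law, and disintegrations are
almost everywhere unique. This serves both to kill the first-layer terms and to identify the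
conditional law of the selectors. -/
lemma condDistrib_ae_eq_map_of_prod {𝒴 : Type*} [MeasurableSpace 𝒴] {Y : Ω → 𝒴}
    (hW : Measurable W) (h : μ.map (fun ω => (Y ω, W ω)) = (μ.map Y).prod (μ.map W)) :
    ∀ᵐ y ∂(μ.map Y), condDistrib W Y μ y = μ.map W := by
  have := condDistrib_ae_eq_of_measure_eq_compProd (κ := Kernel.const 𝒴 (μ.map W)) Y
    hW.aemeasurable (by rw [h, Measure.compProd_const])
  filter_upwards [this] with y hy
  rw [hy, Kernel.const_apply]

lemma expectedWasserstein_eq_zero_of_prod {𝒰 : Type*} [MeasurableSpace 𝒰] {U : Ω → 𝒰}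
    (hW : Measurable W) (hX : Measurable X) (hU : Measurable U)
    (h : μ.map (fun ω => ((X ω, U ω), W ω)) = (μ.map fun ω => (X ω, U ω)).prod (μ.map W)) :
    expectedWasserstein discreteDist μ W X U = 0 := by
  have h' : μ.map (fun ω => (X ω, W ω)) = (μ.map X).prod (μ.map W) := by
    have e := congrArg (Measure.map (Prod.map Prod.fst id)) h
    rw [Measure.map_map (measurable_fst.prodMap measurable_id) ((hX.prodMk hU).prodMk hW),
      ← Measure.map_prod_map _ _ measurable_fst measurable_id,
      Measure.map_map measurable_fst (hX.prodMk hU), Measure.map_id] at e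
    exact e
  have h1 := ae_of_ae_map (hX.prodMk hU).aemeasurable (condDistrib_ae_eq_map_of_prod hW h)
  have h2 := ae_of_ae_map hX.aemeasurable (condDistrib_ae_eq_map_of_prod hW h')
  rw [expectedWasserstein, lintegral_congr_ae (g := fun _ => 0), lintegral_zero]
  filter_upwards [h1, h2] with ω e1 e2
  rw [e1, e2, wasserstein_discreteDist_self]

end OneNode

/-! ### Sign correlations and conditional mutual information -/

section MutualInformation

variable {n : ℕ} {γ 𝒲 : Type*} [MeasurableSpace γ] [MeasurableSpace 𝒲]

/-- The exponential tilt by `∑ j, c s(u_j) g_j - n c² / 2`, with `|g_j| ≤ 1`, has mean at most `1`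
under uniform selectors. -/
lemma integral_exp_sum_selSign_le_one (g : Fin n → ℝ) (hg : ∀ j, |g j| ≤ 1) (c : ℝ) :
    ∫ u, Real.exp (∑ j, c * (selSign (u j) * g j) - n * c ^ 2 / 2)
      ∂(Measure.pi fun _ : Fin n => coin) ≤ 1 := by
  simp_rw [Real.exp_sub, Real.exp_sum]
  rw [integral_div, div_le_one (Real.exp_pos _),
    integral_fintype_prod_eq_prod (fun j (u : Fin 2) => Real.exp (c * (selSign u * g j)))]
  calc ∏ j, ∫ u, Real.exp (c * (selSign u * g j)) ∂coin
      ≤ ∏ _j : Fin n, Real.exp (c ^ 2 / 2) := by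
        refine Finset.prod_le_prod (fun j _ => integral_nonneg fun u => (Real.exp_pos _).le)
          fun j _ => ?_
        rw [integral_coin]
        -- Each factor is a symmetric two-point moment generating function, subgaussian because cosh
        -- x ≤ exp(x²/2).
        have : (Real.exp (c * (selSign 0 * g j)) + Real.exp (c * (selSign 1 * g j))) / 2 =
            Real.cosh (c * g j) := by
          rw [Real.cosh_eq]; simp [selSign]
        rw [this]
        refine (Real.cosh_le_exp_half_sq _).trans (Real.exp_le_exp.2 ?_)
        have : (g j) ^ 2 ≤ 1 := (sq_le_one_iff_abs_le_one _).2 (hg j)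
        rw [mul_pow]
        nlinarith [sq_nonneg c]
    _ = Real.exp (n * c ^ 2 / 2) := by
        rw [Finset.prod_const, ← Real.exp_nat_mul]
        simp [mul_div_assoc]

variable {Ω : Type*} [MeasurableSpace Ω] [StandardBorelSpace 𝒲] [Nonempty 𝒲]
  {μ : Measure Ω} [IsProbabilityMeasure μ] {W : Ω → 𝒲} {J : Ω → Fin n → Fin 2} {Z : Ω → γ}

/-- Correlations of the signs of uniform selectors with bounded functions of the output are
controlled by conditional mutual information. -/
lemma ofReal_sum_integral_le_condMutualInfo (hW : Measurable W) (hJ : Measurable J)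
    (hZ : Measurable Z)
    (hZJ : μ.map (fun ω => (Z ω, J ω)) = (μ.map Z).prod (Measure.pi fun _ => coin))
    {h : Fin n → γ → 𝒲 → ℝ} (hh : ∀ j, Measurable (Function.uncurry (h j)))
    (hb : ∀ j z w, |h j z w| ≤ 1) (c : ℝ) :
    ENNReal.ofReal (∑ j, c * (∫ ω, selSign (J ω j) * h j (Z ω) (W ω) ∂μ) - n * c ^ 2 / 2) ≤
      condMutualInfo μ W J Z := by
  have hmJ : μ.map J = Measure.pi fun _ => coin := by
    have e := congrArg Measure.snd hZJ
    have : IsProbabilityMeasure (μ.map Z) := Measure.isProbabilityMeasure_map hZ.aemeasurable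
    rwa [Measure.snd_map_prodMk hZ, Measure.snd_prod] at e
  have hJc := condDistrib_ae_eq_map_of_prod (Y := Z) hJ (by rw [hZJ, hmJ])
  rw [hmJ] at hJc
  -- One Donsker–Varadhan test function for all n selectors together, so that a single mutual
  -- information controls the whole sum.
  let f : γ → 𝒲 × (Fin n → Fin 2) → ℝ := fun z p =>
    ∑ j, c * (selSign (p.2 j) * h j z p.1) - n * c ^ 2 / 2
  have hs : ∀ j, Measurable fun u : Fin n → Fin 2 => selSign (u j) := fun j =>
    measurable_selSign.comp (measurable_pi_apply j)
  have hf : Measurable (Function.uncurry f) := by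
    change Measurable fun q : γ × 𝒲 × (Fin n → Fin 2) =>
      ∑ j, c * (selSign (q.2.2 j) * h j q.1 q.2.1) - n * c ^ 2 / 2
    have hj : ∀ j, Measurable fun q : γ × 𝒲 × (Fin n → Fin 2) =>
        c * (selSign (q.2.2 j) * h j q.1 q.2.1) := fun j =>
      (((hs j).comp (measurable_snd.comp measurable_snd)).mul
        ((hh j).comp (measurable_fst.prodMk (measurable_fst.comp measurable_snd)))).const_mul c
    exact (Finset.measurable_fun_sum Finset.univ fun j _ => hj j).sub_const (n * c ^ 2 / 2)
  have hterm : ∀ j z w u, |selSign u * h j z w| ≤ 1 := fun j z w u => by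
    rw [abs_mul, abs_selSign, one_mul]; exact hb j z w
  have hfb : ∀ z p, |f z p| ≤ n * |c| + n * c ^ 2 / 2 := fun z p => by
    have hq : 0 ≤ (n : ℝ) * c ^ 2 / 2 := by positivity
    refine (abs_sub (∑ j, c * (selSign (p.2 j) * h j z p.1)) (n * c ^ 2 / 2)).trans
      (add_le_add ?_ (abs_of_nonneg hq).le)
    calc _ ≤ ∑ j, |c * (selSign (p.2 j) * h j z p.1)| := Finset.abs_sum_le_sum_abs _ _
      _ ≤ ∑ _j : Fin n, |c| := by
          refine Finset.sum_le_sum fun j _ => ?_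
          rw [abs_mul]
          exact mul_le_of_le_one_right (abs_nonneg c) (hterm j z p.1 (p.2 j))
      _ = n * |c| := by simp
  have hWJ := hW.prodMk hJ
  have hE : ∫ ω, f (Z ω) (W ω, J ω) ∂μ =
      ∑ j, c * (∫ ω, selSign (J ω j) * h j (Z ω) (W ω) ∂μ) - n * c ^ 2 / 2 := by
    have hi : ∀ j, Integrable (fun ω => selSign (J ω j) * h j (Z ω) (W ω)) μ := fun j =>
      Integrable.of_bound (((hs j).comp hJ).mul
        ((hh j).comp (hZ.prodMk hW))).aestronglyMeasurable 1 (ae_of_all _ fun ω => hterm _ _ _ _)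
    simp only [f]
    rw [integral_sub (integrable_finsetSum _ fun j _ => (hi j).const_mul c) (integrable_const _),
      integral_finsetSum _ fun j _ => (hi j).const_mul c]
    simp [integral_const_mul]
  rw [← hE, ← integral_integral_condDistrib_of_bdd hWJ hZ hf hfb,
    ← integral_map (f := fun z => ∫ p, f z p ∂(condDistrib (fun ω => (W ω, J ω)) Z μ z))
      hZ.aemeasurable (StronglyMeasurable.integral_kernel_prod_right
        hf.stronglyMeasurable).aestronglyMeasurable]
  rw [condMutualInfo]
  let F : γ → ℝ := fun z => ∫ p, f z p ∂(condDistrib (fun ω => (W ω, J ω)) Z μ z)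
  have hF : ENNReal.ofReal (∫ z, F z ∂(μ.map Z)) ≤ ∫⁻ z, ENNReal.ofReal (F z) ∂(μ.map Z) :=
    ofReal_integral_le_lintegral_ofReal
  refine hF.trans (lintegral_mono_ae ?_)
  refine hJc.mono fun z hz => ?_
  have hfz : Measurable (f z) := hf.of_uncurry_left
  -- For almost every z the selectors are still independent uniform coins, so in the reference
  -- measure the exponential moment factors over j for each fixed w.
  rw [hz]
  refine ofReal_integral_le_klDiv (condDistrib (fun ω => (W ω, J ω)) Z μ z)
    ((condDistrib W Z μ z).prod (Measure.pi fun _ : Fin n => coin)) hfz (hfb z) ?_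
  rw [integral_prod _ (Integrable.of_bound hfz.exp.aestronglyMeasurable
    (Real.exp (n * |c| + n * c ^ 2 / 2)) (ae_of_all _ fun p => ?_))]
  · have hle : ∀ w, ∫ u, Real.exp (f z (w, u)) ∂(Measure.pi fun _ : Fin n => coin) ≤ 1 := fun w =>
      integral_exp_sum_selSign_le_one (fun j => h j z w) (fun j => hb j z w) c
    refine (integral_mono_of_nonneg (ae_of_all _ fun w => integral_nonneg fun u =>
      (Real.exp_pos _).le) (integrable_const (1 : ℝ)) (ae_of_all _ hle)).trans ?_
    simp
  · rw [Real.norm_eq_abs, Real.abs_exp]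
    exact Real.exp_le_exp.2 ((le_abs_self _).trans (hfb z p))

end MutualInformation

/-! ### Product measures and coordinatewise kernels -/

section Product

variable {ι : Type*} [Fintype ι]

/-- Resampling one coordinate leaves a product measure invariant. -/
lemma map_update_prod_pi [DecidableEq ι] {X : ι → Type*} [∀ i, MeasurableSpace (X i)]
    (μ : ∀ i, Measure (X i)) [∀ i, IsProbabilityMeasure (μ i)] (k : ι) :
    ((Measure.pi μ).prod (μ k)).map (fun p => Function.update p.1 k p.2) = Measure.pi μ := by
  refine (Measure.pi_eq fun s hs => ?_).symm
  rw [Measure.map_apply measurable_update' (.univ_pi hs)]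
  have : (fun p : (∀ i, X i) × X k => Function.update p.1 k p.2) ⁻¹' Set.univ.pi s =
      (Set.univ.pi (Function.update s k Set.univ)) ×ˢ s k := by
    ext ⟨x, y⟩
    simp only [Set.mem_preimage, Set.mem_univ_pi, Set.mem_prod]
    constructor
    · refine fun h => ⟨fun i => ?_, by simpa using h k⟩
      rcases eq_or_ne i k with rfl | hi
      · simp
      · simpa [hi] using h i
    · rintro ⟨h1, h2⟩ i
      rcases eq_or_ne i k with rfl | hi
      · simpa using h2
      · simpa [hi] using h1 i
  rw [this, Measure.prod_prod, Measure.pi_pi, mul_comm,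
    ← Finset.mul_prod_erase Finset.univ _ (Finset.mem_univ k),
    ← Finset.mul_prod_erase Finset.univ _ (Finset.mem_univ k), Function.update_self,
    measure_univ, one_mul]
  congr 1
  refine Finset.prod_congr rfl fun i hi => ?_
  rw [Function.update_of_ne (Finset.ne_of_mem_erase hi)]

lemma lintegral_pi_prod_eq_prod {X : ι → Type*} [∀ i, MeasurableSpace (X i)]
    (μ : ∀ i, Measure (X i)) [∀ i, IsProbabilityMeasure (μ i)] {f : ∀ i, X i → ℝ≥0∞}
    (hf : ∀ i, Measurable (f i)) :
    ∫⁻ x, ∏ i, f i (x i) ∂(Measure.pi μ) = ∏ i, ∫⁻ x, f i x ∂(μ i) := by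
  have h := lintegral_prod_eq_prod_lintegral_of_indepFun (μ := Measure.pi μ)
    Finset.univ (fun i x => f i (x i))
    (iIndepFun_pi (X := f) fun i => (hf i).aemeasurable)
    fun i => (hf i).comp (measurable_pi_apply i)
  rw [h]
  refine Finset.prod_congr rfl fun i _ => ?_
  rw [← (measurePreserving_eval μ i).lintegral_comp (hf i)]

/-- Coordinatewise kernels acting on a product measure. -/
lemma map_zip_pi_compProd_kernelPi {X Y : ι → Type*} [∀ i, MeasurableSpace (X i)]
    [∀ i, MeasurableSpace (Y i)] (μ : ∀ i, Measure (X i)) [∀ i, IsProbabilityMeasure (μ i)]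
    (κ : ∀ i, Kernel (X i) (Y i)) [∀ i, IsMarkovKernel (κ i)] :
    (Measure.pi μ ⊗ₘ kernelPi fun i => (κ i).comap (fun x : ∀ i, X i => x i)
      (measurable_pi_apply i)).map (fun p i => (p.1 i, p.2 i)) =
      Measure.pi fun i => μ i ⊗ₘ κ i := by
  have hz : Measurable fun (p : (∀ i, X i) × (∀ i, Y i)) i => (p.1 i, p.2 i) :=
    measurable_pi_lambda _ fun i => ((measurable_pi_apply i).comp measurable_fst).prodMk
      ((measurable_pi_apply i).comp measurable_snd)
  refine (Measure.pi_eq fun s hs => ?_).symm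
  rw [Measure.map_apply hz (.univ_pi hs), Measure.compProd_apply (hz (.univ_pi hs))]
  have : ∀ x : ∀ i, X i, (kernelPi (fun i => (κ i).comap (fun x : ∀ i, X i => x i)
      (measurable_pi_apply i)) x) (Prod.mk x ⁻¹' ((fun p i => (p.1 i, p.2 i)) ⁻¹' Set.univ.pi s)) =
      ∏ i, κ i (x i) (Prod.mk (x i) ⁻¹' s i) := fun x => by
    rw [← Measure.pi_pi]
    change Measure.pi (fun i => κ i (x i)) _ = _
    congr 1
  simp_rw [this]
  rw [lintegral_pi_prod_eq_prod μ fun i => Kernel.measurable_kernel_prodMk_left (hs i)]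
  exact Finset.prod_congr rfl fun i _ => (Measure.compProd_apply (hs i)).symm

lemma map_unzip_pi {α β : Type*} [MeasurableSpace α] [MeasurableSpace β] (μ : ι → Measure α)
    (ν : ι → Measure β) [∀ i, IsProbabilityMeasure (μ i)] [∀ i, IsProbabilityMeasure (ν i)] :
    (Measure.pi fun i => (μ i).prod (ν i)).map (fun x => (fun i => (x i).1, fun i => (x i).2)) =
      (Measure.pi μ).prod (Measure.pi ν) :=
  (measurePreserving_arrowProdEquivProdArrow α β ι μ ν).map_eq

lemma pi_dirac_eq {α : Type*} [MeasurableSpace α] (a : ι → α) :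
    (Measure.pi fun i => Measure.dirac (a i)) = Measure.dirac a := by
  refine Measure.pi_eq fun s hs => ?_
  rw [Measure.dirac_apply' _ (.univ_pi hs)]
  simp_rw [Measure.dirac_apply' _ (hs _)]
  by_cases h : a ∈ Set.univ.pi s
  · rw [Set.indicator_of_mem h]
    refine (Finset.prod_eq_one fun i _ => ?_).symm
    rw [Set.indicator_of_mem (h i (Set.mem_univ i))]; rfl
  · rw [Set.indicator_of_notMem h]
    obtain ⟨i, hi⟩ : ∃ i, a i ∉ s i := by simpa [Set.mem_univ_pi] using h
    exact (Finset.prod_eq_zero (Finset.mem_univ i) (Set.indicator_of_notMem hi _)).symm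

end Product

/-! ### Selected and unselected candidates of a leaf -/

section Node

variable {𝒵 : Type*} [MeasurableSpace 𝒵]

/-- The law of a pair of candidates with an independent uniform selector. -/
def nodeLaw (p : Measure 𝒵) : Measure (SuperNode 𝒵) :=
  (Measure.pi fun _ : Fin 2 => p).prod coin

instance (p : Measure 𝒵) [IsProbabilityMeasure p] : IsProbabilityMeasure (nodeLaw p) := by
  unfold nodeLaw; infer_instance

/-- The candidate which is not selected. -/
def SuperNode.unselected {Y : Type*} (x : SuperNode Y) : Y := x.1 (x.2 + 1)

lemma measurable_unselected :
    Measurable (SuperNode.unselected : SuperNode 𝒵 → 𝒵) :=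
  measurable_from_prod_countable_left fun u => measurable_pi_apply (u + 1)

/-- For each fixed selector value the ordered pair (selected, unselected) is the candidate pair,
possibly transposed, and p ⊗ p is symmetric. -/
lemma map_selected_unselected_nodeLaw (p : Measure 𝒵) [IsProbabilityMeasure p] :
    (nodeLaw p).map (fun x => (x.selected, x.unselected)) = p.prod p := by
  have hm : Measurable fun x : SuperNode 𝒵 => (x.selected, x.unselected) :=
    measurable_selected.prodMk measurable_unselected
  refine (Measure.prod_eq fun s t hs ht => ?_).symm
  rw [Measure.map_apply hm (hs.prod ht), nodeLaw, Measure.prod_apply_symm (hm (hs.prod ht))]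
  have : ∀ u : Fin 2, (Measure.pi fun _ : Fin 2 => p) ((fun x => (x, u)) ⁻¹'
      ((fun x : SuperNode 𝒵 => (x.selected, x.unselected)) ⁻¹' s ×ˢ t)) = p s * p t := fun u => by
    have e : (fun x => (x, u)) ⁻¹'
        ((fun x : SuperNode 𝒵 => (x.selected, x.unselected)) ⁻¹' s ×ˢ t) =
        Set.univ.pi fun i => if i = u then s else t := by
      ext x
      simp only [Set.mem_preimage, Set.mem_prod, SuperNode.selected, SuperNode.unselected,
        Set.mem_univ_pi, Fin.forall_fin_two]
      fin_cases u
      · simp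
      · simp [and_comm]
    rw [e, Measure.pi_pi, Fin.prod_univ_two]
    fin_cases u
    · simp
    · simp [mul_comm]
  simp_rw [this]
  simp

lemma superKernel_evalKernel_apply (p : ProbabilityMeasure 𝒵) :
    superKernel (evalKernel 𝒵) p = nodeLaw (p : Measure 𝒵) := by
  rw [superKernel, Kernel.prod_apply, Kernel.const_apply]; rfl

end Node

/-! ### The supersample law for deterministic client distributions -/

section TreeLaw

variable {𝒵 : Type*} [MeasurableSpace 𝒵] {K n : ℕ}

/-- The law of a first-layer node whose candidates are both `p`. -/
def firstLaw (p : ProbabilityMeasure 𝒵) : Measure (SuperNode (ProbabilityMeasure 𝒵)) :=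
  (Measure.pi fun _ : Fin 2 => Measure.dirac p).prod coin

instance (p : ProbabilityMeasure 𝒵) : IsProbabilityMeasure (firstLaw p) := by
  unfold firstLaw; infer_instance

/-- The law of the subtree of a client with data distribution `p`. -/
def clientLaw (n : ℕ) (p : ProbabilityMeasure 𝒵) :
    Measure (SuperNode (ProbabilityMeasure 𝒵) × (Fin n → SuperNode 𝒵)) :=
  (firstLaw p).prod (Measure.pi fun _ => nodeLaw (p : Measure 𝒵))

instance (p : ProbabilityMeasure 𝒵) : IsProbabilityMeasure (clientLaw n p) := by
  unfold clientLaw; infer_instance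

/-- Whichever candidate is selected, it equals p almost surely, so the children do not depend on the
first layer. -/
lemma firstLaw_compProd_comap_selected {Y : Type*} [MeasurableSpace Y] (p : ProbabilityMeasure 𝒵)
    (κ : Kernel (ProbabilityMeasure 𝒵) Y) [IsMarkovKernel κ] :
    firstLaw p ⊗ₘ κ.comap SuperNode.selected measurable_selected = (firstLaw p).prod (κ p) := by
  refine (Measure.prod_eq fun s t hs ht => ?_).symm
  rw [Measure.compProd_apply_prod hs ht, firstLaw, pi_dirac_eq, Measure.dirac_prod,
    setLIntegral_map hs (Kernel.measurable_coe _ ht) measurable_prodMk_left,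
    Measure.map_apply measurable_prodMk_left hs]
  simp only [Kernel.comap_apply, SuperNode.selected]
  rw [setLIntegral_const, mul_comm]

lemma superTreeLaw_deterministicLayer (P : Fin K → ProbabilityMeasure 𝒵) :
    superTreeLaw (deterministicLayer P) n = Measure.pi fun k => clientLaw n (P k) := by
  unfold superTreeLaw
  congr 1
  funext k
  refine (firstLaw_compProd_comap_selected (P k) _).trans ?_
  rw [clientLaw]
  congr 1
  change (Measure.pi fun _ => superKernel (evalKernel 𝒵) (P k)) = _
  simp_rw [superKernel_evalKernel_apply]

lemma dataLaw_deterministicLayer (P : Fin K → ProbabilityMeasure 𝒵) :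
    dataLaw (deterministicLayer P) n =
      Measure.pi fun k => Measure.pi fun _ => (P k : Measure 𝒵) := by
  unfold dataLaw
  congr 1
  funext k
  exact Measure.dirac_bind (Kernel.measurable _) (P k)

/-- The unselected points form a ghost sample independent of the training set: the splitting at each
leaf is unzipped first over j and then over k, and one ghost coordinate is kept. -/
lemma map_data_unselected (P : Fin K → ProbabilityMeasure 𝒵) (k : Fin K) (j : Fin n) :
    (superTreeLaw (deterministicLayer P) n).map
      (fun t => (t.data, ((t k).2 j).unselected)) =
      (dataLaw (deterministicLayer P) n).prod (P k : Measure 𝒵) := by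
  let g : (Fin n → SuperNode 𝒵) → Fin n → 𝒵 × 𝒵 := fun l j => ((l j).selected, (l j).unselected)
  have hsu : Measurable fun x : SuperNode 𝒵 => (x.selected, x.unselected) :=
    measurable_selected.prodMk measurable_unselected
  have hg : Measurable g := measurable_pi_lambda _ fun j => hsu.comp (measurable_pi_apply j)
  let z : (Fin n → 𝒵 × 𝒵) → (Fin n → 𝒵) × (Fin n → 𝒵) :=
    fun x => (fun i => (x i).1, fun i => (x i).2)
  have hz : Measurable z :=
    (measurable_pi_lambda _ fun i => measurable_fst.comp (measurable_pi_apply i)).prodMk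
      (measurable_pi_lambda _ fun i => measurable_snd.comp (measurable_pi_apply i))
  have hclient : ∀ k, (clientLaw n (P k)).map (fun x => z (g x.2)) =
      (Measure.pi fun _ : Fin n => (P k : Measure 𝒵)).prod
        (Measure.pi fun _ : Fin n => (P k : Measure 𝒵)) := fun k => by
    have e : (clientLaw n (P k)).map Prod.snd = Measure.pi fun _ => nodeLaw (P k : Measure 𝒵) := by
      rw [clientLaw, Measure.map_snd_prod, measure_univ, one_smul]
    have e2 : (Measure.pi fun _ : Fin n => nodeLaw (P k : Measure 𝒵)).map g =
        Measure.pi fun _ : Fin n => (P k : Measure 𝒵).prod (P k : Measure 𝒵) := by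
      rw [← map_selected_unselected_nodeLaw]
      have : ∀ _ : Fin n, SigmaFinite ((nodeLaw (P k : Measure 𝒵)).map
          fun x : SuperNode 𝒵 => (x.selected, x.unselected)) := fun _ => by
        rw [map_selected_unselected_nodeLaw]; infer_instance
      exact Measure.pi_map_pi fun _ => hsu.aemeasurable
    rw [← map_unzip_pi, ← e2, ← e, Measure.map_map hg measurable_snd,
      Measure.map_map hz (hg.comp measurable_snd)]
    rfl
  have htree : (superTreeLaw (deterministicLayer P) n).map (fun t k => z (g (t k).2)) =
      Measure.pi fun k => (Measure.pi fun _ : Fin n => (P k : Measure 𝒵)).prod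
        (Measure.pi fun _ : Fin n => (P k : Measure 𝒵)) := by
    rw [superTreeLaw_deterministicLayer]
    simp_rw [← hclient]
    have : ∀ k, SigmaFinite ((clientLaw n (P k)).map fun x => z (g x.2)) := fun k => by
      rw [hclient]; infer_instance
    exact Measure.pi_map_pi (f := fun _ (x : SuperNode (ProbabilityMeasure 𝒵) × (Fin n → SuperNode 𝒵)) => z (g x.2)) fun k =>
      (hz.comp (hg.comp measurable_snd)).aemeasurable
  have hf : Measurable fun (t : SuperTree 𝒵 K n) k => z (g (t k).2) :=
    measurable_pi_lambda _ fun k =>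
      hz.comp (hg.comp (measurable_snd.comp (measurable_pi_apply k)))
  have hu : Measurable fun x : Fin K → (Fin n → 𝒵) × (Fin n → 𝒵) =>
      ((fun k => (x k).1), fun k => (x k).2) :=
    (measurable_pi_lambda _ fun i => measurable_fst.comp (measurable_pi_apply i)).prodMk
      (measurable_pi_lambda _ fun i => measurable_snd.comp (measurable_pi_apply i))
  have hev : Measurable fun o : Fin K → Fin n → 𝒵 => o k j :=
    (measurable_pi_apply j).comp (measurable_pi_apply k)
  have hP : (Measure.pi fun k => Measure.pi fun _ : Fin n => (P k : Measure 𝒵)).map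
      (fun o => o k j) = (P k : Measure 𝒵) :=
    ((measurePreserving_eval (fun _ : Fin n => (P k : Measure 𝒵)) j).comp
      (measurePreserving_eval (fun k => Measure.pi fun _ : Fin n => (P k : Measure 𝒵)) k)).map_eq
  have := congrArg (Measure.map (fun x : Fin K → (Fin n → 𝒵) × (Fin n → 𝒵) =>
      ((fun k => (x k).1), fun k => (x k).2))) htree
  rw [map_unzip_pi, Measure.map_map hu hf] at this
  replace this := congrArg (Measure.map (Prod.map id fun o : Fin K → Fin n → 𝒵 => o k j)) this
  rw [Measure.map_map (measurable_id.prodMap hev) (hu.comp hf),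
    ← Measure.map_prod_map _ _ measurable_id hev, Measure.map_id, hP] at this
  rw [dataLaw_deterministicLayer]
  exact this

end TreeLaw

/-! ### Marginals and independence under the training law -/

section Training

variable {𝒵 𝒪 : Type*} [MeasurableSpace 𝒵] [MeasurableSpace 𝒪] {K n : ℕ}
  (P : Fin K → ProbabilityMeasure 𝒵) (alg : Kernel (Fin K → Fin n → 𝒵) 𝒪) [IsMarkovKernel alg]

lemma measurable_leaves (k : Fin K) :
    Measurable fun ω : SuperTree 𝒵 K n × 𝒪 => (ω.1 k).2 :=
  measurable_snd.comp ((measurable_pi_apply k).comp measurable_fst)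

lemma map_leaves_trainingLaw (k : Fin K) :
    (trainingLaw (deterministicLayer P) alg).map (fun ω => (ω.1 k).2) =
      Measure.pi fun _ => nodeLaw (P k : Measure 𝒵) := by
  have h1 : (trainingLaw (deterministicLayer P) alg).map Prod.fst =
      Measure.pi fun k => clientLaw n (P k) := by
    rw [← superTreeLaw_deterministicLayer]; exact Measure.fst_compProd _ _
  have h2 : (clientLaw n (P k)).map Prod.snd = Measure.pi fun _ => nodeLaw (P k : Measure 𝒵) := by
    rw [clientLaw, Measure.map_snd_prod, measure_univ, one_smul]
  rw [← h2, ← (measurePreserving_eval (fun k => clientLaw n (P k)) k).map_eq, ← h1,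
    Measure.map_map (measurable_pi_apply k) measurable_fst,
    Measure.map_map measurable_snd ((measurable_pi_apply k).comp measurable_fst)]
  rfl

lemma map_leaf_trainingLaw (k : Fin K) (j : Fin n) :
    (trainingLaw (deterministicLayer P) alg).map
      (fun ω => (((ω.1 k).2 j).1, ((ω.1 k).2 j).2)) =
      ((trainingLaw (deterministicLayer P) alg).map fun ω => ((ω.1 k).2 j).1).prod coin := by
  have h : (trainingLaw (deterministicLayer P) alg).map (fun ω => (ω.1 k).2 j) =
      nodeLaw (P k : Measure 𝒵) := by
    rw [← (measurePreserving_eval (fun _ : Fin n => nodeLaw (P k : Measure 𝒵)) j).map_eq,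
      ← map_leaves_trainingLaw P alg k,
      Measure.map_map (measurable_pi_apply j) (measurable_leaves k)]
    rfl
  have h' : (trainingLaw (deterministicLayer P) alg).map (fun ω => ((ω.1 k).2 j).1) =
      Measure.pi fun _ : Fin 2 => (P k : Measure 𝒵) := by
    have := congrArg (Measure.map Prod.fst) h
    have hj : Measurable fun ω : SuperTree 𝒵 K n × 𝒪 => (ω.1 k).2 j :=
      (measurable_pi_apply j).comp (measurable_leaves k)
    rw [Measure.map_map measurable_fst hj, nodeLaw, Measure.map_fst_prod, measure_univ, one_smul] at this
    exact this
  rw [h']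
  exact h

/-- The marginal of the subtree of client k ignores the algorithm, so its selectors are independent
coins given the pairs. This is the hypothesis under which mutual information controls sign
correlations. -/
lemma map_pairs_selectors_trainingLaw (k : Fin K) :
    (trainingLaw (deterministicLayer P) alg).map
      (fun ω => ((fun j => ((ω.1 k).2 j).1), fun j => ((ω.1 k).2 j).2)) =
      ((trainingLaw (deterministicLayer P) alg).map fun ω j => ((ω.1 k).2 j).1).prod
        (Measure.pi fun _ => coin) := by
  have hu : Measurable fun x : Fin n → SuperNode 𝒵 => ((fun i => (x i).1), fun i => (x i).2) :=
    (measurable_pi_lambda _ fun i => measurable_fst.comp (measurable_pi_apply i)).prodMk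
      (measurable_pi_lambda _ fun i => measurable_snd.comp (measurable_pi_apply i))
  have h := congrArg (Measure.map fun x : Fin n → SuperNode 𝒵 =>
    ((fun i => (x i).1), fun i => (x i).2)) (map_leaves_trainingLaw P alg k)
  unfold nodeLaw at h
  rw [map_unzip_pi, Measure.map_map hu (measurable_leaves k)] at h
  have h' := congrArg (Measure.map Prod.fst) h
  rw [Measure.map_map measurable_fst (hu.comp (measurable_leaves k)), Measure.map_fst_prod,
    measure_univ, one_smul] at h'
  refine h.trans ?_
  rw [← h']
  rfl

lemma integral_trainingLaw {G : SuperTree 𝒵 K n → 𝒪 → ℝ} (hG : Measurable (Function.uncurry G))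
    {C : ℝ} (hC : ∀ t w, |G t w| ≤ C) :
    ∫ ω, G ω.1 ω.2 ∂(trainingLaw (deterministicLayer P) alg) =
      ∫ t, ∫ w, G t w ∂(alg t.data) ∂(superTreeLaw (deterministicLayer P) n) :=
  Measure.integral_compProd (f := Function.uncurry G)
    (Integrable.of_bound hG.aestronglyMeasurable C (ae_of_all _ fun p => hC p.1 p.2))

/-- The output is independent of the first layer. -/
lemma map_first_output_trainingLaw (k : Fin K) :
    (trainingLaw (deterministicLayer P) alg).map (fun ω => ((ω.1 k).1, ω.2)) =
      ((trainingLaw (deterministicLayer P) alg).map fun ω => (ω.1 k).1).prod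
        ((trainingLaw (deterministicLayer P) alg).map Prod.snd) := by
  have hf : Measurable fun ω : SuperTree 𝒵 K n × 𝒪 => (ω.1 k).1 :=
    measurable_fst.comp ((measurable_pi_apply k).comp measurable_fst)
  have hu : Measurable fun x : SuperTree 𝒵 K n => ((fun i => (x i).1), fun i => (x i).2) :=
    (measurable_pi_lambda _ fun i => measurable_fst.comp (measurable_pi_apply i)).prodMk
      (measurable_pi_lambda _ fun i => measurable_snd.comp (measurable_pi_apply i))
  have hsel : Measurable fun (l : Fin K → Fin n → SuperNode 𝒵) k j => (l k j).selected :=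
    measurable_pi_lambda _ fun k => measurable_pi_lambda _ fun j =>
      measurable_selected.comp ((measurable_pi_apply j).comp (measurable_pi_apply k))
  -- The algorithm reads only the leaves, which are independent of the first layer, so rectangle
  -- probabilities factor. Taking `s` or `t` to be everything identifies the two factors as the
  -- marginals.
  have key : ∀ s t, MeasurableSet s → MeasurableSet t →
      (trainingLaw (deterministicLayer P) alg) ((fun ω => ((ω.1 k).1, ω.2)) ⁻¹' s ×ˢ t) =
        (∫⁻ f : Fin K → SuperNode (ProbabilityMeasure 𝒵), s.indicator 1 (f k)
          ∂(Measure.pi fun k => firstLaw (P k))) *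
        ∫⁻ l : Fin K → Fin n → SuperNode 𝒵, alg (fun k j => (l k j).selected) t
          ∂(Measure.pi fun k => Measure.pi fun _ => nodeLaw (P k : Measure 𝒵)) := by
    intro s t hs ht
    have hind : Measurable fun f : Fin K → SuperNode (ProbabilityMeasure 𝒵) =>
        s.indicator (1 : SuperNode (ProbabilityMeasure 𝒵) → ℝ≥0∞) (f k) :=
      (measurable_one.indicator hs).comp (measurable_pi_apply k)
    have halg : Measurable fun l : Fin K → Fin n → SuperNode 𝒵 =>
        alg (fun k j => (l k j).selected) t := (alg.measurable_coe ht).comp hsel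
    have hprod : Measurable fun z : (Fin K → SuperNode (ProbabilityMeasure 𝒵)) ×
        (Fin K → Fin n → SuperNode 𝒵) => s.indicator (1 : SuperNode (ProbabilityMeasure 𝒵) → ℝ≥0∞)
          (z.1 k) * alg (fun k j => (z.2 k j).selected) t :=
      (hind.comp measurable_fst).mul (halg.comp measurable_snd)
    rw [← lintegral_prod_mul hind.aemeasurable halg.aemeasurable, ← map_unzip_pi,
      lintegral_map hprod hu, trainingLaw,
      Measure.compProd_apply ((hf.prodMk measurable_snd) (hs.prod ht)),
      superTreeLaw_deterministicLayer]
    refine lintegral_congr fun x => ?_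
    rw [Kernel.comap_apply]
    by_cases h : (x k).1 ∈ s
    · rw [Set.indicator_of_mem h, Pi.one_apply, one_mul]
      congr 1
      ext w
      simp [h]
    · rw [Set.indicator_of_notMem h, zero_mul]
      convert measure_empty (μ := alg x.data)
      ext w
      simp [h]
  have : IsProbabilityMeasure ((trainingLaw (deterministicLayer P) alg).map fun ω => (ω.1 k).1) :=
    Measure.isProbabilityMeasure_map hf.aemeasurable
  have : IsProbabilityMeasure ((trainingLaw (deterministicLayer P) alg).map Prod.snd) :=
    Measure.isProbabilityMeasure_map measurable_snd.aemeasurable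
  refine (Measure.prod_eq fun s t hs ht => ?_).symm
  rw [Measure.map_apply (hf.prodMk measurable_snd) (hs.prod ht), Measure.map_apply hf hs,
    Measure.map_apply measurable_snd ht, key s t hs ht]
  have h1 := key s Set.univ hs .univ
  have h2 := key Set.univ t .univ ht
  simp only [measure_univ, lintegral_const, mul_one, Set.indicator_univ, Pi.one_apply,
    one_mul] at h1 h2
  rw [← h1, ← h2]
  congr 2
  · ext ω; simp
  · ext ω; simp

end Training

/-! ### Generalization error bounded by the Wasserstein bound -/

section Generalization

variable {𝒵 𝒲 : Type*} [MeasurableSpace 𝒵] [MeasurableSpace 𝒲] {K n : ℕ}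
  (P : Fin K → ProbabilityMeasure 𝒵) (alg : Kernel (Fin K → Fin n → 𝒵) 𝒲) [IsMarkovKernel alg]
  {ℓ : 𝒲 → 𝒵 → ℝ}

/-- The contribution of a data point to the generalization error is the effect of swapping it with
the candidate that was not selected. -/
lemma integral_selected_sub_unselected (hℓ : Measurable (Function.uncurry ℓ)) {C : ℝ}
    (hC : ∀ w z, |ℓ w z| ≤ C) (k : Fin K) (j : Fin n) :
    ∫ ω, (ℓ ω.2 ((ω.1 k).2 j).selected - ℓ ω.2 ((ω.1 k).2 j).unselected)
        ∂(trainingLaw (deterministicLayer P) alg) =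
      ∫ s, ∫ w, (ℓ w (s k j) - ∫ z, ℓ w z ∂(P k : Measure 𝒵)) ∂(alg s)
        ∂(dataLaw (deterministicLayer P) n) := by
  have hleaf : Measurable fun t : SuperTree 𝒵 K n => (t k).2 j :=
    (measurable_pi_apply j).comp (measurable_snd.comp (measurable_pi_apply k))
  have hC2 : ∀ w z z', |ℓ w z - ℓ w z'| ≤ C + C := fun w z z' =>
    (abs_sub _ _).trans (add_le_add (hC w z) (hC w z'))
  have hdata : IsProbabilityMeasure (dataLaw (deterministicLayer P) n) := by
    rw [dataLaw_deterministicLayer]; infer_instance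
  have hkj : Measurable fun s : Fin K → Fin n → 𝒵 => s k j :=
    (measurable_pi_apply j).comp (measurable_pi_apply k)
  have hG : Measurable (Function.uncurry fun (t : SuperTree 𝒵 K n) w =>
      ℓ w ((t k).2 j).selected - ℓ w ((t k).2 j).unselected) :=
    (hℓ.comp (measurable_snd.prodMk (measurable_selected.comp (hleaf.comp measurable_fst)))).sub
      (hℓ.comp (measurable_snd.prodMk (measurable_unselected.comp (hleaf.comp measurable_fst))))
  have hdiff : Measurable fun p : ((Fin K → Fin n → 𝒵) × 𝒵) × 𝒲 =>
      ℓ p.2 (p.1.1 k j) - ℓ p.2 p.1.2 :=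
    (hℓ.comp (measurable_snd.prodMk
      (hkj.comp (measurable_fst.comp measurable_fst)))).sub
      (hℓ.comp (measurable_snd.prodMk (measurable_snd.comp measurable_fst)))
  have hF : StronglyMeasurable fun p : (Fin K → Fin n → 𝒵) × 𝒵 =>
      ∫ w, (ℓ w (p.1 k j) - ℓ w p.2) ∂(alg p.1) :=
    StronglyMeasurable.integral_kernel_prod_right (κ := alg.comap Prod.fst measurable_fst)
      hdiff.stronglyMeasurable
  rw [integral_trainingLaw P alg hG fun t w => hC2 _ _ _]
  calc _ = ∫ p, ∫ w, (ℓ w (p.1 k j) - ℓ w p.2) ∂(alg p.1)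
        ∂((dataLaw (deterministicLayer P) n).prod (P k : Measure 𝒵)) := by
        have hdu : Measurable fun t : SuperTree 𝒵 K n => (t.data, ((t k).2 j).unselected) :=
          measurable_data.prodMk (measurable_unselected.comp hleaf)
        rw [← map_data_unselected P k j, integral_map hdu.aemeasurable hF.aestronglyMeasurable]
        rfl
    _ = ∫ s, ∫ z, ∫ w, (ℓ w (s k j) - ℓ w z) ∂(alg s) ∂(P k : Measure 𝒵)
        ∂(dataLaw (deterministicLayer P) n) :=
        integral_prod _ (Integrable.of_bound hF.aestronglyMeasurable (C + C)
          (ae_of_all _ fun p => abs_integral_le_of_abs_le fun w => hC2 _ _ _))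
    _ = _ := by
        refine integral_congr_ae (ae_of_all _ fun s => ?_)
        have hm : Measurable fun q : 𝒵 × 𝒲 => ℓ q.2 (s k j) - ℓ q.2 q.1 :=
          (hℓ.comp (measurable_snd.prodMk measurable_const)).sub
            (hℓ.comp (measurable_snd.prodMk measurable_fst))
        -- For fixed training data, Fubini integrates the ghost point before the hypothesis and
        -- turns its loss into the population risk of client k.
        have hswap := integral_integral_swap (μ := (P k : Measure 𝒵)) (ν := alg s)
          (f := fun z w => ℓ w (s k j) - ℓ w z)
          (Integrable.of_bound hm.aestronglyMeasurable (C + C) (ae_of_all _ fun q => hC2 _ _ _))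
        refine hswap.trans (integral_congr_ae (ae_of_all _ fun w => ?_))
        have hw : Integrable (fun z => ℓ w z) (P k : Measure 𝒵) :=
          Integrable.of_bound (hℓ.of_uncurry_left).aestronglyMeasurable C
            (ae_of_all _ fun z => hC w z)
        change ∫ z, (ℓ w (s k j) - ℓ w z) ∂(P k : Measure 𝒵) = _
        rw [integral_sub (integrable_const _) hw]
        simp

lemma popRisk_deterministicLayer (hℓ : Measurable (Function.uncurry ℓ)) (w : 𝒲) :
    popRisk (deterministicLayer P) ℓ w =
      (1 / (K : ℝ)) * ∑ k, ∫ z, ℓ w z ∂(P k : Measure 𝒵) := by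
  have h : StronglyMeasurable fun p : ProbabilityMeasure 𝒵 => ∫ z, ℓ w z ∂(p : Measure 𝒵) :=
    StronglyMeasurable.integral_kernel_prod_right (κ := evalKernel 𝒵) (f := fun _ z => ℓ w z)
      ((hℓ.of_uncurry_left (x := w)).comp measurable_snd).stronglyMeasurable
  unfold popRisk deterministicLayer
  simp_rw [integral_dirac' _ _ h]

lemma genError_deterministicLayer (hK : 0 < K) (hn : 0 < n)
    (hℓ : Measurable (Function.uncurry ℓ)) {C : ℝ} (hC : ∀ w z, |ℓ w z| ≤ C) :
    genError (deterministicLayer P) alg ℓ = -((1 / ((K : ℝ) * n)) * ∑ k, ∑ j,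
      ∫ ω, (ℓ ω.2 ((ω.1 k).2 j).selected - ℓ ω.2 ((ω.1 k).2 j).unselected)
        ∂(trainingLaw (deterministicLayer P) alg)) := by
  have hK' : (K : ℝ) ≠ 0 := by positivity
  have hn' : (n : ℝ) ≠ 0 := by positivity
  have hdata : IsProbabilityMeasure (dataLaw (deterministicLayer P) n) := by
    rw [dataLaw_deterministicLayer]; infer_instance
  have hpt : ∀ w (s : Fin K → Fin n → 𝒵), popRisk (deterministicLayer P) ℓ w - empRisk ℓ w s =
      -((1 / ((K : ℝ) * n)) * ∑ k, ∑ j, (ℓ w (s k j) - ∫ z, ℓ w z ∂(P k : Measure 𝒵))) := by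
    intro w s
    rw [popRisk_deterministicLayer P hℓ, empRisk]
    simp only [Finset.sum_sub_distrib, Finset.sum_const, Finset.card_univ, Fintype.card_fin,
      nsmul_eq_mul]
    rw [← Finset.mul_sum]
    field_simp
    ring
  have hkj : ∀ k j, Measurable fun s : Fin K → Fin n → 𝒵 => s k j := fun k j =>
    (measurable_pi_apply j).comp (measurable_pi_apply k)
  have hpop : ∀ k, Measurable fun w => ∫ z, ℓ w z ∂(P k : Measure 𝒵) := fun k =>
    (StronglyMeasurable.integral_prod_right (f := ℓ) hℓ.stronglyMeasurable).measurable
  have hterm : ∀ k j, Measurable fun q : (Fin K → Fin n → 𝒵) × 𝒲 =>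
      ℓ q.2 (q.1 k j) - ∫ z, ℓ q.2 z ∂(P k : Measure 𝒵) := fun k j =>
    (hℓ.comp (measurable_snd.prodMk ((hkj k j).comp measurable_fst))).sub
      ((hpop k).comp measurable_snd)
  have hb : ∀ k j w (s : Fin K → Fin n → 𝒵),
      |ℓ w (s k j) - ∫ z, ℓ w z ∂(P k : Measure 𝒵)| ≤ C + C := fun k j w s =>
    (abs_sub _ _).trans (add_le_add (hC _ _) (abs_integral_le_of_abs_le fun z => hC w z))
  have hi : ∀ k j s, Integrable (fun w => ℓ w (s k j) - ∫ z, ℓ w z ∂(P k : Measure 𝒵)) (alg s) :=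
    fun k j s => Integrable.of_bound
      ((hterm k j).comp measurable_prodMk_left).aestronglyMeasurable (C + C)
      (ae_of_all _ fun w => hb k j w s)
  have hI : ∀ k j, Integrable (fun s => ∫ w, (ℓ w (s k j) - ∫ z, ℓ w z ∂(P k : Measure 𝒵)) ∂(alg s))
      (dataLaw (deterministicLayer P) n) := fun k j =>
    Integrable.of_bound (StronglyMeasurable.integral_kernel_prod_right (κ := alg)
      (f := fun s w => ℓ w (s k j) - ∫ z, ℓ w z ∂(P k : Measure 𝒵)) (hterm k j).stronglyMeasurable).aestronglyMeasurable (C + C)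
      (ae_of_all _ fun s => abs_integral_le_of_abs_le fun w => hb k j w s)
  unfold genError
  simp_rw [hpt, integral_neg, integral_const_mul, integral_selected_sub_unselected P alg hℓ hC]
  congr 2
  have e1 : ∀ s, ∫ w, ∑ k, ∑ j, (ℓ w (s k j) - ∫ z, ℓ w z ∂(P k : Measure 𝒵)) ∂(alg s) =
      ∑ k, ∑ j, ∫ w, (ℓ w (s k j) - ∫ z, ℓ w z ∂(P k : Measure 𝒵)) ∂(alg s) := fun s => by
    rw [integral_finsetSum _ fun k _ => integrable_finsetSum _ fun j _ => hi k j s]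
    exact Finset.sum_congr rfl fun k _ => integral_finsetSum _ fun j _ => hi k j s
  simp_rw [e1]
  rw [integral_finsetSum _ fun k _ => integrable_finsetSum _ fun j _ => hI k j]
  exact Finset.sum_congr rfl fun k _ => integral_finsetSum _ fun j _ => hI k j

variable [StandardBorelSpace 𝒲] [Nonempty 𝒲]

lemma ofReal_abs_genError_le_wassersteinBound (hK : 0 < K) (hn : 0 < n)
    (hℓ : Measurable (Function.uncurry ℓ)) {a b : ℝ} (hab : ∀ w z, ℓ w z ∈ Set.Icc a b) :
    ENNReal.ofReal |genError (deterministicLayer P) alg ℓ| ≤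
      wassersteinBound (deterministicLayer P) discreteDist (b - a) alg := by
  have hC : ∀ w z, |ℓ w z| ≤ max |a| |b| := fun w z => abs_le_max_abs_abs (hab w z).1 (hab w z).2
  have hKn : 0 < (K : ℝ) * n := by positivity
  rw [genError_deterministicLayer P alg hK hn hℓ hC, abs_neg, abs_mul,
    abs_of_pos (one_div_pos.2 hKn), ENNReal.ofReal_mul (one_div_pos.2 hKn).le,
    ENNReal.ofReal_div_of_pos hKn, ENNReal.ofReal_mul (Nat.cast_nonneg K), ENNReal.ofReal_one,
    ENNReal.ofReal_natCast, ENNReal.ofReal_natCast, wassersteinBound, mul_add, mul_left_comm]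
  -- The nonnegative first-layer part of the bound is discarded.
  refine le_add_left ?_
  rw [mul_left_comm]
  gcongr
  rw [Finset.mul_sum]
  refine (ENNReal.ofReal_le_ofReal (Finset.abs_sum_le_sum_abs _ _)).trans ?_
  rw [ENNReal.ofReal_sum_of_nonneg fun _ _ => abs_nonneg _]
  refine Finset.sum_le_sum fun k _ => ?_
  rw [Finset.mul_sum]
  refine (ENNReal.ofReal_le_ofReal (Finset.abs_sum_le_sum_abs _ _)).trans ?_
  rw [ENNReal.ofReal_sum_of_nonneg fun _ _ => abs_nonneg _]
  refine Finset.sum_le_sum fun j _ => ?_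
  have hleaf : Measurable fun ω : SuperTree 𝒵 K n × 𝒲 => (ω.1 k).2 j :=
    (measurable_pi_apply j).comp (measurable_leaves k)
  exact ofReal_abs_integral_sub_flip_le (φ := fun (y : (Fin 2 → 𝒵) × Fin 2) w => ℓ w (y.1 y.2))
    measurable_snd (measurable_fst.comp hleaf) (measurable_snd.comp hleaf)
    (map_leaf_trainingLaw P alg k j)
    (hℓ.comp (measurable_snd.prodMk (measurable_selected.comp measurable_fst)))
    fun y w => hab _ _

lemma expectedWasserstein_first_eq_zero (k : Fin K) :
    expectedWasserstein discreteDist (trainingLaw (deterministicLayer P) alg) Prod.snd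
      (fun ω => (ω.1 k).1.1) (fun ω => (ω.1 k).1.2) = 0 := by
  have hf : Measurable fun ω : SuperTree 𝒵 K n × 𝒲 => (ω.1 k).1 :=
    measurable_fst.comp ((measurable_pi_apply k).comp measurable_fst)
  exact expectedWasserstein_eq_zero_of_prod measurable_snd (measurable_fst.comp hf)
    (measurable_snd.comp hf) (map_first_output_trainingLaw P alg k)

end Generalization

/-! ### From the global hypothesis to the local one -/

section DataProcessing

variable {𝒵 𝒲 : Type*} [MeasurableSpace 𝒵] [MeasurableSpace 𝒲] {K n : ℕ}
  (P : Fin K → ProbabilityMeasure 𝒵) (A : Fin K → Kernel (Fin n → 𝒵) 𝒲) [∀ k, IsMarkovKernel (A k)]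
  (B : Kernel (Fin K → 𝒲) 𝒲) [IsMarkovKernel B]

/-- A subtree of a client. -/
abbrev ClientTree (𝒵 : Type*) [MeasurableSpace 𝒵] (n : ℕ) :=
  SuperNode (ProbabilityMeasure 𝒵) × (Fin n → SuperNode 𝒵)

/-- The selected data of a client. -/
def ClientTree.data (x : ClientTree 𝒵 n) : Fin n → 𝒵 := fun j => (x.2 j).selected

lemma measurable_clientData : Measurable (ClientTree.data : ClientTree 𝒵 n → _) :=
  measurable_pi_lambda _ fun j =>
    measurable_selected.comp ((measurable_pi_apply j).comp measurable_snd)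

/-- The joint law of the subtree of a client and of its local hypothesis. -/
def clientTrainingLaw (k : Fin K) : Measure (ClientTree 𝒵 n × 𝒲) :=
  clientLaw n (P k) ⊗ₘ (A k).comap ClientTree.data measurable_clientData

instance (k : Fin K) : IsProbabilityMeasure (clientTrainingLaw P A k) := by
  unfold clientTrainingLaw; infer_instance

/-- The joint law of the subtrees and local hypotheses of all clients. -/
abbrev localLaw : Measure (Fin K → ClientTree 𝒵 n × 𝒲) :=
  Measure.pi fun k => clientTrainingLaw P A k

/-- Each client acts only on its own subtree, so the pairs (subtree, local hypothesis) are
independent across clients. -/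
lemma map_zip_superTreeLaw :
    (superTreeLaw (deterministicLayer P) n ⊗ₘ (kernelPi fun k => (A k).comap
      (fun s : Fin K → Fin n → 𝒵 => s k) (measurable_pi_apply k)).comap
        SuperTree.data measurable_data).map (fun p i => (p.1 i, p.2 i)) = localLaw P A := by
  rw [superTreeLaw_deterministicLayer]
  exact map_zip_pi_compProd_kernelPi (fun k => clientLaw n (P k))
    fun k => (A k).comap ClientTree.data measurable_clientData

lemma integral_trainingLaw_federatedKernel
    {G : SuperTree 𝒵 K n → (Fin K → 𝒲) → 𝒲 → ℝ}
    (hG : Measurable fun p : SuperTree 𝒵 K n × (Fin K → 𝒲) × 𝒲 => G p.1 p.2.1 p.2.2)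
    {C : ℝ} (hC : ∀ t v w, |G t v w| ≤ C) :
    ∫ ω, G ω.1 ω.2.1 ω.2.2 ∂(trainingLaw (deterministicLayer P) (federatedKernel A B)) =
      ∫ q, ∫ w, G (fun i => (q i).1) (fun i => (q i).2) w ∂(B fun i => (q i).2)
        ∂(localLaw P A) := by
  let L := kernelPi fun k => (A k).comap (fun s : Fin K → Fin n → 𝒵 => s k) (measurable_pi_apply k)
  have hz : Measurable fun (p : SuperTree 𝒵 K n × (Fin K → 𝒲)) i => (p.1 i, p.2 i) :=
    measurable_pi_lambda _ fun i => ((measurable_pi_apply i).comp measurable_fst).prodMk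
      ((measurable_pi_apply i).comp measurable_snd)
  have h1 : Measurable fun (q : Fin K → ClientTree 𝒵 n × 𝒲) i => (q i).1 :=
    measurable_pi_lambda _ fun i => measurable_fst.comp (measurable_pi_apply i)
  have h2 : Measurable fun (q : Fin K → ClientTree 𝒵 n × 𝒲) i => (q i).2 :=
    measurable_pi_lambda _ fun i => measurable_snd.comp (measurable_pi_apply i)
  have hR : StronglyMeasurable fun q : Fin K → ClientTree 𝒵 n × 𝒲 =>
      ∫ w, G (fun i => (q i).1) (fun i => (q i).2) w ∂(B fun i => (q i).2) :=
    StronglyMeasurable.integral_kernel_prod_right (κ := B.comap _ h2)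
      (f := fun (q : Fin K → ClientTree 𝒵 n × 𝒲) w => G (fun i => (q i).1) (fun i => (q i).2) w)
      (hG.comp ((h1.comp measurable_fst).prodMk
        ((h2.comp measurable_fst).prodMk measurable_snd))).stronglyMeasurable
  have hR' : StronglyMeasurable fun p : SuperTree 𝒵 K n × (Fin K → 𝒲) =>
      ∫ w, G p.1 p.2 w ∂(B p.2) := hR.comp_measurable hz
  rw [← map_zip_superTreeLaw, integral_map hz.aemeasurable hR.aestronglyMeasurable]
  change _ = ∫ p, ∫ w, G p.1 p.2 w ∂(B p.2)
    ∂(superTreeLaw (deterministicLayer P) n ⊗ₘ L.comap SuperTree.data measurable_data)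
  rw [integral_trainingLaw P (federatedKernel A B) (G := fun t o => G t o.1 o.2) hG
      fun t o => hC _ _ _,
    Measure.integral_compProd (Integrable.of_bound hR'.aestronglyMeasurable C
      (ae_of_all _ fun p => abs_integral_le_of_abs_le fun w => hC _ _ _))]
  refine integral_congr_ae (ae_of_all _ fun t => ?_)
  exact integral_compProd (f := fun o : (Fin K → 𝒲) × 𝒲 => G t o.1 o.2)
    (Integrable.of_bound (hG.comp measurable_prodMk_left).aestronglyMeasurable C
      (ae_of_all _ fun p => hC _ _ _))

/-- The Wasserstein terms see only the global output, while the mutual information needs the local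
hypotheses; this links the two training laws. -/
lemma integral_trainingLaw_snd_federatedKernel {G : SuperTree 𝒵 K n → 𝒲 → ℝ}
    (hG : Measurable (Function.uncurry G)) {C : ℝ} (hC : ∀ t w, |G t w| ≤ C) :
    ∫ ω, G ω.1 ω.2 ∂(trainingLaw (deterministicLayer P) (federatedKernel A B).snd) =
      ∫ ω, G ω.1 ω.2.2 ∂(trainingLaw (deterministicLayer P) (federatedKernel A B)) := by
  rw [integral_trainingLaw P _ hG hC,
    integral_trainingLaw P (federatedKernel A B) (G := fun t o => G t o.2)
      (hG.comp (measurable_fst.prodMk (measurable_snd.comp measurable_snd))) fun t o => hC _ _]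
  refine integral_congr_ae (ae_of_all _ fun t => ?_)
  change ∫ w, G t w ∂((federatedKernel A B).snd t.data) = _
  rw [Kernel.snd_apply, integral_map measurable_snd.aemeasurable
    (hG.of_uncurry_left).aestronglyMeasurable]

/-- A test of the global hypothesis against the selector of a data point can be replaced by a test
of the local hypothesis of the same client. -/
lemma exists_local_test_function (k : Fin K) (j : Fin n) {h : (Fin 2 → 𝒵) → 𝒲 → ℝ}
    (hh : Measurable (Function.uncurry h)) (hb : ∀ x w, |h x w| ≤ 1) :
    ∃ h' : (Fin n → Fin 2 → 𝒵) → 𝒲 → ℝ, Measurable (Function.uncurry h') ∧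
      (∀ z v, |h' z v| ≤ 1) ∧
      ∫ ω, selSign ((ω.1 k).2 j).2 * h ((ω.1 k).2 j).1 ω.2
          ∂(trainingLaw (deterministicLayer P) (federatedKernel A B).snd) =
        ∫ ω, selSign ((ω.1 k).2 j).2 * h' (fun i => ((ω.1 k).2 i).1) (ω.2.1 k)
          ∂(trainingLaw (deterministicLayer P) (federatedKernel A B)) := by
  let Q := Fin K → ClientTree 𝒵 n × 𝒲
  have h2 : Measurable fun (q : Q) i => (q i).2 :=
    measurable_pi_lambda _ fun i => measurable_snd.comp (measurable_pi_apply i)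
  -- A full independent copy of all clients is drawn and its k-th hypothesis overwritten by the true
  -- one. Then `h'` averages `h` over that copy and the server, leaving a function of the pairs and
  -- hypothesis of client k.
  let u : 𝒲 × Q → Fin K → 𝒲 := fun p => Function.update (fun i => (p.2 i).2) k p.1
  have hu : Measurable u := measurable_update'.comp ((h2.comp measurable_snd).prodMk measurable_fst)
  let r : ((Fin n → Fin 2 → 𝒵) × 𝒲) × Q → ℝ := fun p => ∫ w, h (p.1.1 j) w ∂(B (u (p.1.2, p.2)))
  have hup : Measurable fun p : ((Fin n → Fin 2 → 𝒵) × 𝒲) × Q => u (p.1.2, p.2) :=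
    hu.comp ((measurable_snd.comp measurable_fst).prodMk measurable_snd)
  have hzj : Measurable fun p : (((Fin n → Fin 2 → 𝒵) × 𝒲) × Q) × 𝒲 => p.1.1.1 j :=
    (measurable_pi_apply j).comp (measurable_fst.comp (measurable_fst.comp measurable_fst))
  have hr : StronglyMeasurable r :=
    StronglyMeasurable.integral_kernel_prod_right (κ := B.comap _ hup)
      (f := fun (p : ((Fin n → Fin 2 → 𝒵) × 𝒲) × Q) w => h (p.1.1 j) w)
      (hh.comp (g := Function.uncurry h) (hzj.prodMk measurable_snd)).stronglyMeasurable
  have hrb : ∀ p, |r p| ≤ 1 := fun p => abs_integral_le_of_abs_le fun w => hb _ _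
  let h' : (Fin n → Fin 2 → 𝒵) → 𝒲 → ℝ := fun z v => ∫ q, r ((z, v), q) ∂(localLaw P A)
  have hh' : Measurable (Function.uncurry h') :=
    (StronglyMeasurable.integral_prod_right (f := fun p q => r (p, q)) hr).measurable
  have hb' : ∀ z v, |h' z v| ≤ 1 := fun z v => abs_integral_le_of_abs_le fun q => hrb _
  refine ⟨h', hh', hb', ?_⟩
  have hleaf : Measurable fun t : SuperTree 𝒵 K n => (t k).2 j :=
    (measurable_pi_apply j).comp (measurable_snd.comp (measurable_pi_apply k))
  have hsgn : Measurable fun t : SuperTree 𝒵 K n => selSign ((t k).2 j).2 :=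
    measurable_selSign.comp (measurable_snd.comp hleaf)
  have hpair : Measurable fun (x : ClientTree 𝒵 n) i => (x.2 i).1 :=
    measurable_pi_lambda _ fun i =>
      measurable_fst.comp ((measurable_pi_apply i).comp measurable_snd)
  have habs : ∀ s (x : ℝ), |x| ≤ 1 → |selSign s * x| ≤ 1 := fun s x hx => by
    rwa [abs_mul, abs_selSign, one_mul]
  have hGm : Measurable (Function.uncurry fun (t : SuperTree 𝒵 K n) w =>
      selSign ((t k).2 j).2 * h ((t k).2 j).1 w) :=
    (hsgn.comp measurable_fst).mul (hh.comp ((measurable_fst.comp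
      (hleaf.comp measurable_fst)).prodMk measurable_snd))
  have hsgn' : Measurable fun y : ClientTree 𝒵 n × 𝒲 => selSign (y.1.2 j).2 :=
    measurable_selSign.comp (measurable_snd.comp
      ((measurable_pi_apply j).comp (measurable_snd.comp measurable_fst)))
  have hzv : Measurable fun y : ClientTree 𝒵 n × 𝒲 => ((fun i => (y.1.2 i).1), y.2) :=
    (hpair.comp measurable_fst).prodMk measurable_snd
  let φ : ClientTree 𝒵 n × 𝒲 → ℝ := fun y => selSign (y.1.2 j).2 * h' (fun i => (y.1.2 i).1) y.2
  have hφ : Measurable φ := hsgn'.mul (hh'.comp hzv)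
  have hGm' : Measurable fun p : SuperTree 𝒵 K n × (Fin K → 𝒲) × 𝒲 =>
      selSign ((p.1 k).2 j).2 * h' (fun i => ((p.1 k).2 i).1) (p.2.1 k) := by
    have hkv : Measurable fun p : SuperTree 𝒵 K n × (Fin K → 𝒲) × 𝒲 => (p.1 k, p.2.1 k) :=
      ((measurable_pi_apply k).comp measurable_fst).prodMk
        ((measurable_pi_apply k).comp (measurable_fst.comp measurable_snd))
    exact hφ.comp hkv
  have hS : StronglyMeasurable fun q : Q =>
      ∫ w, selSign ((q k).1.2 j).2 * h ((q k).1.2 j).1 w ∂(B fun i => (q i).2) :=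
    StronglyMeasurable.integral_kernel_prod_right (κ := B.comap _ h2)
      (f := fun (q : Q) w => selSign ((q k).1.2 j).2 * h ((q k).1.2 j).1 w)
      (hGm.comp (((measurable_pi_lambda (fun (q : Q) i => (q i).1) fun i =>
        measurable_fst.comp (measurable_pi_apply i)).comp measurable_fst).prodMk
        measurable_snd)).stronglyMeasurable
  have hupd : Measurable fun p : Q × (ClientTree 𝒵 n × 𝒲) => Function.update p.1 k p.2 :=
    measurable_update'
  have hT : StronglyMeasurable fun p : Q × (ClientTree 𝒵 n × 𝒲) =>
      selSign (p.2.1.2 j).2 * r (((fun i => (p.2.1.2 i).1), p.2.2), p.1) :=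
    ((hsgn'.comp measurable_snd).mul
      (hr.measurable.comp ((hzv.comp measurable_snd).prodMk measurable_fst))).stronglyMeasurable
  rw [integral_trainingLaw_snd_federatedKernel P A B hGm fun t w => habs _ _ (hb _ _),
    integral_trainingLaw_federatedKernel P A B
      (G := fun t _ w => selSign ((t k).2 j).2 * h ((t k).2 j).1 w)
      (hGm.comp (measurable_fst.prodMk (measurable_snd.comp measurable_snd)))
      (fun t v w => habs _ _ (hb _ _)),
    integral_trainingLaw_federatedKernel P A B
      (G := fun t v _ => selSign ((t k).2 j).2 * h' (fun i => ((t k).2 i).1) (v k))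
      hGm' (fun t v w => habs _ _ (hb' _ _))]
  calc ∫ q, ∫ w, selSign ((q k).1.2 j).2 * h ((q k).1.2 j).1 w ∂(B fun i => (q i).2)
        ∂(localLaw P A)
      = ∫ p, selSign (p.2.1.2 j).2 * r (((fun i => (p.2.1.2 i).1), p.2.2), p.1)
          ∂((localLaw P A).prod (clientTrainingLaw P A k)) := by
        -- Redrawing coordinate k preserves the product law, which separates client k from the
        -- clients averaged out in `h'`.
        conv_lhs => rw [localLaw, ← map_update_prod_pi (fun k => clientTrainingLaw P A k) k,
          integral_map hupd.aemeasurable hS.aestronglyMeasurable]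
        refine integral_congr_ae (ae_of_all _ fun p => ?_)
        have e : (fun i => (Function.update p.1 k p.2 i).2) = u (p.2.2, p.1) := by
          funext i
          rcases eq_or_ne i k with rfl | hi
          · simp [u]
          · simp [u, hi]
        change ∫ w, selSign ((Function.update p.1 k p.2 k).1.2 j).2 *
          h ((Function.update p.1 k p.2 k).1.2 j).1 w
            ∂(B fun i => (Function.update p.1 k p.2 i).2) = _
        rw [e, Function.update_self, integral_const_mul]
    _ = ∫ y, φ y ∂(clientTrainingLaw P A k) := by
        rw [integral_prod_symm _ (Integrable.of_bound hT.aestronglyMeasurable 1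
          (ae_of_all _ fun p => habs _ _ (hrb _)))]
        simp_rw [integral_const_mul]
        rfl
    _ = ∫ q, φ (q k) ∂(localLaw P A) := by
        rw [← (measurePreserving_eval (fun k => clientTrainingLaw P A k) k).map_eq,
          integral_map (measurable_pi_apply k).aemeasurable hφ.aestronglyMeasurable]
    _ = _ := by simp [φ]

end DataProcessing

/-! ### Wasserstein bound against mutual information -/

section Comparison

variable {𝒵 𝒲 : Type*} [MeasurableSpace 𝒵] [MeasurableSpace 𝒲] [StandardBorelSpace 𝒲]
  [Nonempty 𝒲] {K n : ℕ}
  (P : Fin K → ProbabilityMeasure 𝒵) (A : Fin K → Kernel (Fin n → 𝒵) 𝒲) [∀ k, IsMarkovKernel (A k)]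
  (B : Kernel (Fin K → 𝒲) 𝒲) [IsMarkovKernel B]

lemma ofReal_le_clientCMI (k : Fin K) {h : Fin n → (Fin n → Fin 2 → 𝒵) → 𝒲 → ℝ}
    (hh : ∀ j, Measurable (Function.uncurry (h j))) (hb : ∀ j z v, |h j z v| ≤ 1) (c : ℝ) :
    ENNReal.ofReal (∑ j, c * (∫ ω, selSign ((ω.1 k).2 j).2 *
        h j (fun i => ((ω.1 k).2 i).1) (ω.2.1 k)
          ∂(trainingLaw (deterministicLayer P) (federatedKernel A B))) - n * c ^ 2 / 2) ≤
      clientCMI (deterministicLayer P) A B k := by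
  have hl : ∀ j, Measurable fun ω : SuperTree 𝒵 K n × (Fin K → 𝒲) × 𝒲 => (ω.1 k).2 j := fun j =>
    (measurable_pi_apply j).comp (measurable_leaves k)
  exact ofReal_sum_integral_le_condMutualInfo
    ((measurable_pi_apply k).comp (measurable_fst.comp measurable_snd))
    (measurable_pi_lambda _ fun j => measurable_snd.comp (hl j))
    (measurable_pi_lambda _ fun j => measurable_fst.comp (hl j))
    (map_pairs_selectors_trainingLaw P (federatedKernel A B) k) hh hb c

/-- Optimization over the tilting parameter. -/
lemma ofReal_mean_le_rpow (hK : 0 < K) (hn : 0 < n) {e : Fin K → Fin n → ℝ}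
    {I : Fin K → ℝ≥0∞}
    (hI : ∀ (c : ℝ) k, ENNReal.ofReal (∑ j, c * e k j - n * c ^ 2 / 2) ≤ I k) :
    ENNReal.ofReal ((1 / ((K : ℝ) * n)) * ∑ k, ∑ j, e k j) ≤
      (2 / ((n : ℝ≥0∞) * K) * ∑ k, I k) ^ (1 / 2 : ℝ) := by
  have hKn : 0 < (n : ℝ) * K := by positivity
  set m := (1 / ((K : ℝ) * n)) * ∑ k, ∑ j, e k j with hm
  rcases le_or_gt m 0 with hm0 | hm0
  · rw [ENNReal.ofReal_of_nonpos hm0]; exact zero_le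
  -- The total exponent is nK(cm - c²/2), maximal at c = m.
  have hsum : ∑ k, (∑ j, m * e k j - n * m ^ 2 / 2) = (n * K) * (m ^ 2 / 2) := by
    have hS : ∑ k, ∑ j, e k j = n * K * m := by
      rw [hm]; field_simp
    simp only [Finset.sum_sub_distrib, ← Finset.mul_sum, hS, Finset.sum_const, Finset.card_univ,
      Fintype.card_fin, nsmul_eq_mul]
    ring
  have hle : ENNReal.ofReal ((n * K) * (m ^ 2 / 2)) ≤ ∑ k, I k := by
    rw [← hsum]
    -- The exponent of a single client may be negative at this common c; subadditivity of
    -- `ENNReal.ofReal` suffices.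
    refine (Finset.le_sum_of_subadditive ENNReal.ofReal ENNReal.ofReal_zero.le
      (fun _ _ => ENNReal.ofReal_add_le) _ _).trans ?_
    exact Finset.sum_le_sum fun k _ => hI m k
  have hc : (2 / ((n : ℝ≥0∞) * K)) = ENNReal.ofReal (2 / (n * K)) := by
    rw [ENNReal.ofReal_div_of_pos hKn, ENNReal.ofReal_mul (Nat.cast_nonneg n),
      ENNReal.ofReal_natCast, ENNReal.ofReal_natCast, ENNReal.ofReal_ofNat]
  calc ENNReal.ofReal m = ((ENNReal.ofReal m) ^ (2 : ℝ)) ^ (1 / 2 : ℝ) := by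
        rw [← ENNReal.rpow_mul]; norm_num
    _ ≤ _ := by
        refine ENNReal.rpow_le_rpow ?_ (by norm_num)
        calc (ENNReal.ofReal m) ^ (2 : ℝ)
            = ENNReal.ofReal (2 / (n * K)) * ENNReal.ofReal ((n * K) * (m ^ 2 / 2)) := by
              rw [← ENNReal.ofReal_mul (by positivity), ENNReal.rpow_two,
                ← ENNReal.ofReal_pow hm0.le]
              congr 1
              field_simp
          _ ≤ _ := by rw [hc]; gcongr

lemma wassersteinBound_le (hK : 0 < K) (hn : 0 < n) (c : ℝ) :
    wassersteinBound (deterministicLayer P) discreteDist c (federatedKernel A B).snd ≤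
      ENNReal.ofReal c * (2 / ((n : ℝ≥0∞) * K) *
        ∑ k, clientCMI (deterministicLayer P) A B k) ^ (1 / 2 : ℝ) := by
  have hKn : 0 < (K : ℝ) * n := by positivity
  have hleaf : ∀ k j, Measurable fun ω : SuperTree 𝒵 K n × 𝒲 => (ω.1 k).2 j := fun k j =>
    (measurable_pi_apply j).comp (measurable_leaves k)
  choose h hh hb hpos hle using fun (k : Fin K) (j : Fin n) =>
    exists_expectedWasserstein_le
      (μ := trainingLaw (deterministicLayer P) (federatedKernel A B).snd) measurable_snd
      (measurable_fst.comp (hleaf k j)) (measurable_snd.comp (hleaf k j))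
      (map_leaf_trainingLaw P (federatedKernel A B).snd k j)
  choose h' hh' hb' heq using fun k j => exists_local_test_function P A B k j (hh k j) (hb k j)
  let e : Fin K → Fin n → ℝ := fun k j => ∫ ω, selSign ((ω.1 k).2 j).2 *
    h' k j (fun i => ((ω.1 k).2 i).1) (ω.2.1 k)
      ∂(trainingLaw (deterministicLayer P) (federatedKernel A B))
  -- Nonnegativity makes `ENNReal.ofReal` additive over the leaves below.
  have hpos' : ∀ k j, 0 ≤ e k j := fun k j => (hpos k j).trans_eq (heq k j)
  have hle' : ∀ k j, expectedWasserstein discreteDist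
      (trainingLaw (deterministicLayer P) (federatedKernel A B).snd) Prod.snd
      (fun ω => ((ω.1 k).2 j).1) (fun ω => ((ω.1 k).2 j).2) ≤ ENNReal.ofReal (e k j / 2) :=
    fun k j => (hle k j).trans_eq (congrArg (fun x => ENNReal.ofReal (x / 2)) (heq k j))
  have hmean := ofReal_mean_le_rpow hK hn fun c k =>
    ofReal_le_clientCMI P A B k (hh' k) (hb' k) c
  change ENNReal.ofReal ((1 / ((K : ℝ) * n)) * ∑ k, ∑ j, e k j) ≤ _ at hmean
  unfold wassersteinBound
  simp_rw [expectedWasserstein_first_eq_zero]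
  rw [Finset.sum_const_zero, mul_zero, zero_add, mul_comm 2, mul_assoc]
  gcongr
  refine le_trans ?_ hmean
  -- The 2 in the Wasserstein bound cancels the 1/2 from the test functions, leaving exactly the
  -- mean of the `e k j`.
  calc _ ≤ 2 * (1 / ((K : ℝ≥0∞) * n) * ∑ k, ∑ j, ENNReal.ofReal (e k j / 2)) := by
        gcongr with k _ j _
        exact hle' k j
    _ = ENNReal.ofReal (2 * (1 / (K * n) * ∑ k, ∑ j, e k j / 2)) := by
        have h0 : ∀ k j, 0 ≤ e k j / 2 := fun k j => div_nonneg (hpos' k j) two_pos.le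
        rw [ENNReal.ofReal_mul two_pos.le, ENNReal.ofReal_mul (one_div_pos.2 hKn).le,
          ENNReal.ofReal_div_of_pos hKn, ENNReal.ofReal_mul (Nat.cast_nonneg K),
          ENNReal.ofReal_sum_of_nonneg fun k _ => Finset.sum_nonneg fun j _ => h0 k j]
        simp_rw [ENNReal.ofReal_sum_of_nonneg fun j (_ : j ∈ Finset.univ) => h0 _ j]
        simp
    _ = _ := by
        congr 1
        simp_rw [← Finset.sum_div]
        ring

end Comparison

end HierFL

end

theorem mainTheorem6 {𝒵 𝒲 : Type*} [MeasurableSpace 𝒵]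
    [MeasurableSpace 𝒲] [StandardBorelSpace 𝒲] [Nonempty 𝒲]
    {K n : ℕ} (hK : 0 < K) (hn : 0 < n)
    (P : Fin K → ProbabilityMeasure 𝒵)
    (A : Fin K → Kernel (Fin n → 𝒵) 𝒲) [∀ k, IsMarkovKernel (A k)]
    (B : Kernel (Fin K → 𝒲) 𝒲) [IsMarkovKernel B]
    (ℓ : 𝒲 → 𝒵 → ℝ) (hℓ : Measurable (Function.uncurry ℓ))
    (a b : ℝ) (hab : ∀ w z, ℓ w z ∈ Set.Icc a b) :
    ENNReal.ofReal
        |HierFL.genError (HierFL.deterministicLayer P) (HierFL.federatedKernel A B).snd ℓ| ≤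
      HierFL.wassersteinBound (HierFL.deterministicLayer P) HierFL.discreteDist (b - a)
        (HierFL.federatedKernel A B).snd ∧
    HierFL.wassersteinBound (HierFL.deterministicLayer P) HierFL.discreteDist (b - a)
        (HierFL.federatedKernel A B).snd ≤
      ENNReal.ofReal (b - a) *
        (2 / ((n : ℝ≥0∞) * K) *
          ∑ k, HierFL.clientCMI (HierFL.deterministicLayer P) A B k) ^ (1 / 2 : ℝ) := by
  exact ⟨HierFL.ofReal_abs_genError_le_wassersteinBound P _ hK hn hℓ hab,
    HierFL.wassersteinBound_le P A B hK hn (b - a)⟩
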